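/- For a finite simple graph $G$ with $n\ge 1$ vertices and $m$ edges, let $\mu_1\ge\mu_2\ge\dots\ge\mu_n=0$ be the eigenvalues, counted with multiplicity, of its Laplacian matrix $L(G)=D(G)-A(G)$, where $D(G)$ is the diagonal matrix of vertex degrees and $A(G)$ is the adjacency matrix. The Laplacian energy of $G$ is $$LE(G)=\sum_{i=1}^{n}\left|\mu_i-\frac{2m}{n}\right|.$$ Let $P_n$ and $S_n$ denote the path and the star on $n$ vertices. Theorem. Every tree $T$ of diameter $4$ with $n$ vertices satisfies $$LE(P_n)\le LE(T)\le LE(S_n).$$ That is, the Laplacian energy conjecture holds for all trees of diameter $4$. -/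

import Mathlib

/-- The average degree `2m / n` of a finite graph with `n` vertices and `m` edges. -/
noncomputable def SimpleGraph.averageDegree {V : Type*} [Fintype V] (G : SimpleGraph V) : ℝ :=
  2 * (G.edgeSet.ncard : ℝ) / (Fintype.card V : ℝ)

open Classical in
/-- The Laplacian energy `∑ᵢ |μᵢ - 2m / n|` of a finite graph, where the `μᵢ` are the eigenvalues,
with multiplicity, of its Laplacian matrix `L(G) = D(G) - A(G)`. -/
noncomputable def SimpleGraph.laplacianEnergy {V : Type*} [Fintype V] (G : SimpleGraph V) : ℝ :=
  ∑ i : V, |(G.isHermitian_lapMatrix ℝ).eigenvalues i - G.averageDegree|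

/-!
The eigenvalues `μᵢ` of the Laplacian of a tree with `n` vertices have mean `d = 2 - 2 / n`, so the
energy is `2 ∑ (μᵢ - d)`, summed over the `k` eigenvalues above `d`. This sum is estimated by
certificates that do not require the spectrum. Orthogonal test vectors `uⱼ` bound it below by the sum
of `uⱼᵀ L uⱼ / |uⱼ|² - d` (`le_laplacianEnergy_of_orthogonal`), and an inequality
`L ≤ c + ∑ τⱼ wⱼ wⱼᵀ` of quadratic forms bounds it above by `(c - d) k + ∑ τⱼ |wⱼ|²`
(`laplacianEnergy_le_of_lapForm_le`); both are Bessel's inequality.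

A tree of diameter four consists of a root with `p` leaves and `r ≥ 2` branches, the `i`-th one being
a neighbour of the root, its hub, with `s i ≥ 1` leaves (`IsTree.exists_depthTwo_equiv`).

Upper bound. The vector with value `n - 1` at the centre and `-1` elsewhere shows that the energy of
the star is at least `2 (n - d)`. For the tree, the certificate has a term for each branch, from the
larger root `tᵢ` of `t² - (s i + 2) t + 1`, which is an eigenvalue of the principal submatrix of the
branch, and a term for the root (`laplacianEnergy_le_of_branch_roots`). The choice `c = 1` is
good for `k > r`, and `c = 5 / 2` for `k ≤ r`; what remains is `∑ 1 / tᵢ ≥ 2 r / n`, a convexity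
estimate available unless `r = 2` and `p = 0`. In that case either the Laplacian is split into
those of two stars sharing the root (`k ≥ 3`), or `c` is chosen more carefully (`k ≤ 2`).

Lower bound. The spectrum of the path is `2 - 2 cos (π j / n)`, and summing the cosines gives that
its energy is at most `4 n / π` (`laplacianEnergy_pathGraph_le`). For the tree, disjointly supported
vectors, one on each branch and one on the root with its leaves, reach this value for `n ≥ 10`, and
for most smaller trees (`le_laplacianEnergy_of_depthTwo`). The seven exceptions with at least six
vertices have explicit test vectors, and the only tree with five vertices is the path.
-/

/-! ### Variational bounds for the Laplacian energy -/

section Spectral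

variable {V : Type*} [Fintype V]

/-- The spectral expansion of the quadratic form of a real symmetric matrix. -/
lemma Matrix.IsHermitian.dotProduct_mulVec_eq_sum_eigenvalues [DecidableEq V]
    {A : Matrix V V ℝ} (hA : A.IsHermitian) (x : V → ℝ) :
    dotProduct x (A.mulVec x) =
      ∑ i, hA.eigenvalues i * (∑ v, hA.eigenvectorBasis i v * x v) ^ 2 := by
  have hin : ∀ y z : V → ℝ, inner ℝ (WithLp.toLp 2 y) (WithLp.toLp 2 z) = dotProduct y z := by
    intro y z
    rw [EuclideanSpace.inner_eq_star_dotProduct, dotProduct_comm]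
    rfl
  have key := hA.eigenvectorBasis.sum_inner_mul_inner (WithLp.toLp 2 x)
    (WithLp.toLp 2 (A.mulVec x))
  rw [hin] at key
  rw [← key]
  refine Finset.sum_congr rfl fun i _ => ?_
  have h1 : inner ℝ (WithLp.toLp 2 x) (hA.eigenvectorBasis i) =
      ∑ v, hA.eigenvectorBasis i v * x v := by
    rw [← real_inner_comm]
    exact hin _ _
  have h2 : inner ℝ (hA.eigenvectorBasis i) (WithLp.toLp 2 (A.mulVec x)) =
      hA.eigenvalues i * ∑ v, hA.eigenvectorBasis i v * x v := by
    have h3 : inner ℝ (hA.eigenvectorBasis i) (WithLp.toLp 2 (A.mulVec x)) =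
        dotProduct (hA.eigenvectorBasis i) (A.mulVec x) := hin _ _
    have hT : A.transpose = A := by simpa using hA.eq
    rw [h3, Matrix.dotProduct_mulVec, ← Matrix.mulVec_transpose, hT,
      hA.mulVec_eigenvectorBasis, smul_dotProduct]
    rfl
  rw [h1, h2]
  ring

lemma OrthonormalBasis.sum_mul_eq_ite [DecidableEq V]
    (b : OrthonormalBasis V ℝ (EuclideanSpace ℝ V)) (i j : V) :
    ∑ v, b i v * b j v = if i = j then 1 else 0 := by
  have h := b.inner_eq_ite i j
  rw [EuclideanSpace.inner_eq_star_dotProduct] at h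
  rw [← h]
  simp [dotProduct, mul_comm]

/-- Bessel's inequality in coordinates. -/
lemma OrthonormalBasis.sum_sq_sum_mul_le
    (b : OrthonormalBasis V ℝ (EuclideanSpace ℝ V)) (s : Finset V) (w : V → ℝ) :
    ∑ i ∈ s, (∑ v, w v * b i v) ^ 2 ≤ ∑ v, w v ^ 2 := by
  have h := b.orthonormal.sum_inner_products_le (WithLp.toLp 2 w) (s := s)
  rw [EuclideanSpace.norm_sq_eq] at h
  simpa [EuclideanSpace.inner_eq_star_dotProduct, dotProduct] using h

/-- Parseval's identity in coordinates. -/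
lemma OrthonormalBasis.sum_sq_sum_mul_eq
    (b : OrthonormalBasis V ℝ (EuclideanSpace ℝ V)) (w : V → ℝ) :
    ∑ i, (∑ v, b i v * w v) ^ 2 = ∑ v, w v ^ 2 := by
  have h := b.sum_sq_norm_inner_right (WithLp.toLp 2 w)
  rw [EuclideanSpace.norm_sq_eq] at h
  simpa [EuclideanSpace.inner_eq_star_dotProduct, dotProduct, mul_comm] using h

/-- Bessel's inequality for a finite family of pairwise orthogonal vectors, not normalised, tested
against a unit vector. -/
lemma sum_sq_div_le_one_of_orthogonal {J : Type*} [Fintype J] (u : J → V → ℝ) (b : V → ℝ)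
    (hb : ∑ v, b v ^ 2 = 1) (hu : Pairwise fun i j => ∑ v, u i v * u j v = 0)
    (hpos : ∀ j, 0 < ∑ v, u j v ^ 2) :
    ∑ j, (∑ v, b v * u j v) ^ 2 / ∑ v, u j v ^ 2 ≤ 1 := by
  classical
  set N : J → ℝ := fun j => ∑ v, u j v ^ 2 with hN
  set a : J → ℝ := fun j => ∑ v, b v * u j v with ha
  have h0 : 0 ≤ ∑ v, (b v - ∑ j, a j / N j * u j v) ^ 2 :=
    Finset.sum_nonneg fun _ _ => sq_nonneg _
  have hexp : ∀ v, (b v - ∑ j, a j / N j * u j v) ^ 2 =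
      b v ^ 2 - 2 * ∑ j, a j / N j * (b v * u j v) +
        ∑ i, ∑ j, a i / N i * (a j / N j) * (u i v * u j v) := by
    intro v
    have e1 : ∑ j, a j / N j * (b v * u j v) = b v * ∑ j, a j / N j * u j v := by
      rw [Finset.mul_sum]; exact Finset.sum_congr rfl fun _ _ => by ring
    have e2 : ∑ i, ∑ j, a i / N i * (a j / N j) * (u i v * u j v) =
        (∑ j, a j / N j * u j v) * ∑ j, a j / N j * u j v := by
      rw [Finset.sum_mul_sum]
      exact Finset.sum_congr rfl fun _ _ => Finset.sum_congr rfl fun _ _ => by ring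
    rw [e1, e2]; ring
  simp_rw [hexp, Finset.sum_add_distrib, Finset.sum_sub_distrib, ← Finset.mul_sum] at h0
  rw [Finset.sum_comm] at h0
  have h2 : ∑ v, ∑ i, ∑ j, a i / N i * (a j / N j) * (u i v * u j v) = ∑ j, a j ^ 2 / N j := by
    rw [Finset.sum_comm]
    refine Finset.sum_congr rfl fun i _ => ?_
    rw [Finset.sum_comm]
    simp_rw [← Finset.mul_sum]
    rw [Finset.sum_eq_single i]
    · have : ∑ v, u i v * u i v = N i := Finset.sum_congr rfl fun _ _ => by ring
      rw [this]
      have := (hpos i).ne'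
      field_simp
    · intro j _ hj
      rw [hu hj.symm, mul_zero]
    · simp
  have h1 : ∑ j, ∑ v, a j / N j * (b v * u j v) = ∑ j, a j ^ 2 / N j := by
    refine Finset.sum_congr rfl fun j _ => ?_
    rw [← Finset.mul_sum]
    change a j / N j * a j = _
    ring
  rw [h1, hb, h2] at h0
  linarith

namespace SimpleGraph

open Classical in
/-- The quadratic form `xᵀ L(G) x` of the Laplacian matrix. -/
noncomputable def lapForm (G : SimpleGraph V) (x : V → ℝ) : ℝ :=
  dotProduct x ((G.lapMatrix ℝ).mulVec x)

open Classical in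
/-- The number of Laplacian eigenvalues exceeding the average degree. -/
noncomputable def numLargeEigenvalues (G : SimpleGraph V) : ℕ :=
  (Finset.univ.filter fun i => G.averageDegree < (G.isHermitian_lapMatrix ℝ).eigenvalues i).card

variable (G : SimpleGraph V)

open Classical in
lemma lapForm_eq (x : V → ℝ) :
    G.lapForm x = (∑ i, ∑ j, if G.Adj i j then (x i - x j) ^ 2 else 0) / 2 := by
  rw [← lapMatrix_toLinearMap₂', Matrix.toLinearMap₂'_apply', lapForm]

open Classical in
lemma lapForm_eigenvectorBasis (i : V) :
    G.lapForm ((G.isHermitian_lapMatrix ℝ).eigenvectorBasis i) =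
      (G.isHermitian_lapMatrix ℝ).eigenvalues i := by
  set hA := G.isHermitian_lapMatrix ℝ
  have h1 := hA.eigenvectorBasis.sum_mul_eq_ite i i
  rw [if_pos rfl] at h1
  rw [lapForm, hA.mulVec_eigenvectorBasis, dotProduct_smul, smul_eq_mul, dotProduct, h1, mul_one]

open Classical in
lemma sum_eigenvalues_eq_two_mul_edges :
    ∑ i, (G.isHermitian_lapMatrix ℝ).eigenvalues i = 2 * (G.edgeSet.ncard : ℝ) := by
  have h := (G.isHermitian_lapMatrix ℝ).trace_eq_sum_eigenvalues
  have h2 : (G.lapMatrix ℝ).trace = ∑ v, (G.degree v : ℝ) := by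
    simp [Matrix.trace, lapMatrix, degMatrix]
  have h3 := G.sum_degrees_eq_twice_card_edges
  have h4 : G.edgeSet.ncard = G.edgeFinset.card := by
    rw [← coe_edgeFinset, Set.ncard_coe_finset]
  rw [h2] at h
  rw [h4]
  calc _ = ∑ v, (G.degree v : ℝ) := h.symm
    _ = _ := by exact_mod_cast h3

open Classical in
lemma sum_eigenvalues_sub_averageDegree :
    ∑ i, ((G.isHermitian_lapMatrix ℝ).eigenvalues i - G.averageDegree) = 0 := by
  rw [Finset.sum_sub_distrib, sum_eigenvalues_eq_two_mul_edges, Finset.sum_const, Finset.card_univ,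
    nsmul_eq_mul, averageDegree]
  rcases isEmpty_or_nonempty V with h | h
  · have : G.edgeSet = ∅ := by
      rw [Set.eq_empty_iff_forall_notMem]
      intro e
      induction e with
      | _ a b => exact (IsEmpty.false a).elim
    simp [this]
  · have : (Fintype.card V : ℝ) ≠ 0 := by exact_mod_cast Fintype.card_ne_zero
    field_simp
    ring

open Classical in
/-- As the eigenvalues average to the average degree, the Laplacian energy is twice the sum of the
excesses of the large ones. -/
lemma laplacianEnergy_eq_two_mul_sum_max :
    G.laplacianEnergy =
      2 * ∑ i, max ((G.isHermitian_lapMatrix ℝ).eigenvalues i - G.averageDegree) 0 := by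
  have h := G.sum_eigenvalues_sub_averageDegree
  have h2 : ∀ x : ℝ, |x| = 2 * max x 0 - x := by
    intro x
    rcases le_total 0 x with hx | hx
    · rw [abs_of_nonneg hx, max_eq_left hx]; ring
    · rw [abs_of_nonpos hx, max_eq_right hx]; ring
  rw [laplacianEnergy]
  simp_rw [h2]
  rw [Finset.sum_sub_distrib, h, ← Finset.mul_sum, sub_zero]

/-- A certificate for an upper bound: if the Laplacian is at most `c` plus a positive combination
of rank-one forms, then Bessel's inequality bounds the sum of the large eigenvalues. The vertices
are labelled by `e`. -/
theorem laplacianEnergy_le_of_lapForm_le {M J : Type*} [Fintype M] [Fintype J] (e : M ≃ V)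
    (c : ℝ) (τ : J → ℝ) (w : J → M → ℝ) (hτ : ∀ j, 0 ≤ τ j)
    (h : ∀ y : M → ℝ, G.lapForm (y ∘ e.symm) ≤
      c * ∑ m, y m ^ 2 + ∑ j, τ j * (∑ m, w j m * y m) ^ 2) :
    G.laplacianEnergy ≤ 2 * ((c - G.averageDegree) * G.numLargeEigenvalues +
      ∑ j, τ j * ∑ m, w j m ^ 2) := by
  classical
  set hA := G.isHermitian_lapMatrix ℝ with hhA
  set d := G.averageDegree
  set s := Finset.univ.filter fun i => d < hA.eigenvalues i with hs
  have hk : G.numLargeEigenvalues = s.card := rfl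
  have h1 : ∑ i, max (hA.eigenvalues i - d) 0 = ∑ i ∈ s, (hA.eigenvalues i - d) := by
    rw [hs, Finset.sum_filter]
    refine Finset.sum_congr rfl fun i _ => ?_
    split_ifs with hi
    · exact max_eq_left (by linarith)
    · exact max_eq_right (by linarith)
  have h2 : ∀ i, hA.eigenvalues i ≤
      c + ∑ j, τ j * (∑ v, (w j ∘ e.symm) v * hA.eigenvectorBasis i v) ^ 2 := by
    intro i
    have h3 := h (hA.eigenvectorBasis i ∘ e)
    have h4 : ((hA.eigenvectorBasis i : V → ℝ) ∘ e) ∘ e.symm = hA.eigenvectorBasis i := by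
      ext v; simp
    rw [h4, G.lapForm_eigenvectorBasis i] at h3
    have h5 : ∑ m, ((hA.eigenvectorBasis i : V → ℝ) ∘ e) m ^ 2 = 1 := by
      have := hA.eigenvectorBasis.sum_mul_eq_ite i i
      rw [if_pos rfl, ← Equiv.sum_comp e] at this
      rw [← this]
      exact Finset.sum_congr rfl fun _ _ => by simp [sq]
    rw [h5, mul_one] at h3
    refine h3.trans_eq ?_
    congr 1
    refine Finset.sum_congr rfl fun j _ => ?_
    rw [← Equiv.sum_comp e (fun v => (w j ∘ e.symm) v * hA.eigenvectorBasis i v)]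
    simp
  rw [laplacianEnergy_eq_two_mul_sum_max, h1, hk]
  refine mul_le_mul_of_nonneg_left ?_ (by norm_num)
  calc ∑ i ∈ s, (hA.eigenvalues i - d)
      ≤ ∑ i ∈ s, ((c - d) +
          ∑ j, τ j * (∑ v, (w j ∘ e.symm) v * hA.eigenvectorBasis i v) ^ 2) :=
        Finset.sum_le_sum fun i _ => by linarith [h2 i]
    _ = (c - d) * s.card +
        ∑ j, τ j * ∑ i ∈ s, (∑ v, (w j ∘ e.symm) v * hA.eigenvectorBasis i v) ^ 2 := by
        rw [Finset.sum_add_distrib, Finset.sum_const, nsmul_eq_mul, Finset.sum_comm]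
        simp_rw [← Finset.mul_sum]
        ring
    _ ≤ _ := by
        refine add_le_add le_rfl (Finset.sum_le_sum fun j _ => ?_)
        refine mul_le_mul_of_nonneg_left ?_ (hτ j)
        refine (hA.eigenvectorBasis.sum_sq_sum_mul_le s _).trans_eq ?_
        rw [← Equiv.sum_comp e]
        simp

/-- A certificate for a lower bound: the excesses of the Rayleigh quotients of pairwise orthogonal
vectors over the average degree. The vertices are labelled by `e`. -/
theorem le_laplacianEnergy_of_orthogonal {M J : Type*} [Fintype M] [Fintype J] (e : M ≃ V)
    (u : J → M → ℝ) (hu : Pairwise fun i j => ∑ m, u i m * u j m = 0)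
    (hpos : ∀ j, 0 < ∑ m, u j m ^ 2) :
    2 * ∑ j, (G.lapForm (u j ∘ e.symm) / (∑ m, u j m ^ 2) - G.averageDegree) ≤
      G.laplacianEnergy := by
  classical
  set hA := G.isHermitian_lapMatrix ℝ with hhA
  set d := G.averageDegree
  set a : J → V → ℝ := fun j i => ∑ v, hA.eigenvectorBasis i v * (u j ∘ e.symm) v with ha
  set N : J → ℝ := fun j => ∑ m, u j m ^ 2 with hN
  have hN' : ∀ j, N j = ∑ v, (u j ∘ e.symm) v ^ 2 := by
    intro j
    rw [← Equiv.sum_comp e]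
    simp [hN]
  have h1 : ∀ j, G.lapForm (u j ∘ e.symm) / N j - d =
      ∑ i, (hA.eigenvalues i - d) * (a j i ^ 2 / N j) := by
    intro j
    have h2 : G.lapForm (u j ∘ e.symm) = ∑ i, hA.eigenvalues i * a j i ^ 2 :=
      hA.dotProduct_mulVec_eq_sum_eigenvalues _
    have h3 : ∑ i, a j i ^ 2 = N j := by
      rw [hN']
      exact hA.eigenvectorBasis.sum_sq_sum_mul_eq _
    have h4 : N j ≠ 0 := (hpos j).ne'
    have h5 : ∑ i, (hA.eigenvalues i - d) * (a j i ^ 2 / N j) =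
        (∑ i, hA.eigenvalues i * a j i ^ 2) / N j - d * ((∑ i, a j i ^ 2) / N j) := by
      rw [Finset.sum_div, Finset.sum_div, Finset.mul_sum, ← Finset.sum_sub_distrib]
      exact Finset.sum_congr rfl fun _ _ => by ring
    rw [h5, h2, h3, div_self h4, mul_one]
  rw [show ∑ j, (G.lapForm (u j ∘ e.symm) / (∑ m, u j m ^ 2) - d) =
    ∑ j, ∑ i, (hA.eigenvalues i - d) * (a j i ^ 2 / N j) from Finset.sum_congr rfl fun j _ => h1 j,
    Finset.sum_comm, laplacianEnergy_eq_two_mul_sum_max]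
  refine mul_le_mul_of_nonneg_left (Finset.sum_le_sum fun i _ => ?_) (by norm_num)
  rw [← Finset.mul_sum]
  have h6 : ∑ j, a j i ^ 2 / N j ≤ 1 := by
    simp_rw [hN']
    refine sum_sq_div_le_one_of_orthogonal (fun j => u j ∘ e.symm) _ ?_ ?_ ?_
    · have := hA.eigenvectorBasis.sum_mul_eq_ite i i
      rw [if_pos rfl] at this
      rw [← this]
      exact Finset.sum_congr rfl fun _ _ => by ring
    · intro j k hjk
      rw [← Equiv.sum_comp e]
      simpa using hu hjk
    · intro j
      rw [← hN']
      exact hpos j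
  have h7 : 0 ≤ ∑ j, a j i ^ 2 / N j :=
    Finset.sum_nonneg fun j _ => div_nonneg (sq_nonneg _) (hpos j).le
  rcases le_total 0 (hA.eigenvalues i - d) with h8 | h8
  · exact (mul_le_of_le_one_right h8 h6).trans (le_max_left _ _)
  · exact (mul_nonpos_of_nonpos_of_nonneg h8 h7).trans (le_max_right _ _)

/-- The Laplacian energy is monotone in the Laplacian form, for graphs of equal average degree. -/
theorem laplacianEnergy_le_of_lapForm_comp_le {W : Type*} [Fintype W] (H : SimpleGraph W)
    (e : W ≃ V) (hd : H.averageDegree = G.averageDegree)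
    (h : ∀ y : W → ℝ, H.lapForm y ≤ G.lapForm (y ∘ e.symm)) :
    H.laplacianEnergy ≤ G.laplacianEnergy := by
  classical
  set hA := H.isHermitian_lapMatrix ℝ with hhA
  set d := H.averageDegree
  have h1 : ∀ i, ∑ w, hA.eigenvectorBasis i w ^ 2 = 1 := by
    intro i
    have := hA.eigenvectorBasis.sum_mul_eq_ite i i
    rw [if_pos rfl] at this
    rw [← this]
    exact Finset.sum_congr rfl fun _ _ => by ring
  have h2 := G.le_laplacianEnergy_of_orthogonal e
    (fun (j : {i // d < hA.eigenvalues i}) => (hA.eigenvectorBasis j : W → ℝ))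
    (by
      intro i j hij
      have := hA.eigenvectorBasis.sum_mul_eq_ite i j
      rwa [if_neg (fun h => hij (Subtype.ext h))] at this)
    (by intro j; rw [h1]; norm_num)
  refine le_trans ?_ h2
  rw [laplacianEnergy_eq_two_mul_sum_max]
  refine mul_le_mul_of_nonneg_left ?_ (by norm_num)
  have h3 : ∑ i, max (hA.eigenvalues i - d) 0 =
      ∑ j : {i // d < hA.eigenvalues i}, (hA.eigenvalues j - d) := by
    rw [← Finset.sum_subtype (Finset.univ.filter fun i => d < hA.eigenvalues i) (by simp)
      (fun i => hA.eigenvalues i - d), Finset.sum_filter]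
    refine Finset.sum_congr rfl fun i _ => ?_
    split_ifs with hi
    · exact max_eq_left (by linarith)
    · exact max_eq_right (by linarith)
  rw [h3]
  refine Finset.sum_le_sum fun j _ => ?_
  rw [h1, div_one, ← hd]
  have := h (hA.eigenvectorBasis j)
  rw [H.lapForm_eigenvectorBasis] at this
  linarith

end SimpleGraph

end Spectral

/-! ### Trees of diameter four -/

/-- The vertices of a tree of depth two: the root, then `r` branches, the `i`-th one consisting of
a neighbour of the root (`none`) and its `s i` leaves, and finally `p` leaves at the root. -/
abbrev DepthTwoVertex {r : ℕ} (s : Fin r → ℕ) (p : ℕ) : Type :=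
  Unit ⊕ ((Σ i : Fin r, Option (Fin (s i))) ⊕ Fin p)

namespace DepthTwoVertex

variable {r : ℕ} {s : Fin r → ℕ} {p : ℕ}

/-- The root. -/
abbrev root : DepthTwoVertex s p := Sum.inl ()

/-- The neighbour of the root in the branch `i`. -/
abbrev hub (i : Fin r) : DepthTwoVertex s p := Sum.inr (Sum.inl ⟨i, none⟩)

/-- The leaf `j` of the branch `i`. -/
abbrev leaf (i : Fin r) (j : Fin (s i)) : DepthTwoVertex s p := Sum.inr (Sum.inl ⟨i, some j⟩)

/-- The leaf `k` at the root. -/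
abbrev pendant (k : Fin p) : DepthTwoVertex s p := Sum.inr (Sum.inr k)

lemma sum_eq (f : DepthTwoVertex s p → ℝ) :
    ∑ m, f m = f root + ((∑ i, (f (hub i) + ∑ j, f (leaf i j))) + ∑ k, f (pendant k)) := by
  rw [Fintype.sum_sum_type, Fintype.sum_sum_type, Fintype.sum_sigma]
  simp [Fintype.sum_option]

lemma card_eq : Fintype.card (DepthTwoVertex s p) = 1 + ((∑ i, (s i + 1)) + p) := by
  simp [Fintype.card_sum, Fintype.card_sigma]

/-- The Laplacian form of the tree of depth two, a sum over its edges. -/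
noncomputable def form (y : DepthTwoVertex s p → ℝ) : ℝ :=
  (∑ i, ((y root - y (hub i)) ^ 2 + ∑ j, (y (hub i) - y (leaf i j)) ^ 2)) +
    ∑ k, (y root - y (pendant k)) ^ 2

end DepthTwoVertex

namespace SimpleGraph

variable {V : Type*} {T : SimpleGraph V}

/-- In a tree with root `w`, a vertex has at most one neighbour closer to the root. -/
lemma IsTree.eq_of_adj_of_dist_add_one_eq (hT : T.IsTree) {w x a b : V} (ha : T.Adj a x)
    (hb : T.Adj b x) (hda : T.dist w a + 1 = T.dist w x) (hdb : T.dist w b + 1 = T.dist w x) :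
    a = b := by
  obtain ⟨p, -, hp⟩ := hT.connected.exists_path_of_dist w a
  obtain ⟨q, -, hq⟩ := hT.connected.exists_path_of_dist w b
  have h1 : (p.concat ha).IsPath :=
    Walk.isPath_of_length_eq_dist _ (by rw [Walk.length_concat, hp, hda])
  have h2 : (q.concat hb).IsPath :=
    Walk.isPath_of_length_eq_dist _ (by rw [Walk.length_concat, hq, hdb])
  have h3 : p.concat ha = q.concat hb :=
    Subtype.mk.inj <| hT.isAcyclic.subsingleton_path w x |>.elim ⟨_, h1⟩ ⟨_, h2⟩
  have h4 := congrArg Walk.penultimate h3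
  simpa using h4

lemma IsTree.exists_adj_dist_add_one_eq (hT : T.IsTree) {o v : V} (hv : v ≠ o) :
    ∃ a, T.Adj v a ∧ T.dist o a + 1 = T.dist o v := by
  obtain ⟨p, -, hp⟩ := hT.connected.exists_path_of_dist v o
  cases p with
  | nil => exact absurd rfl hv
  | @cons _ a _ h q =>
    refine ⟨a, h, ?_⟩
    have h1 := dist_le q
    rw [Walk.length_cons, dist_comm] at hp
    rw [dist_comm] at h1
    rcases hT.dist_eq_dist_add_one_of_adj o h with h2 | h2 <;> omega

open Classical in
/-- A rooted tree has a parent function, and its Laplacian form is the sum over the non-root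
vertices of the squared differences to the parent. -/
lemma IsTree.exists_parent [Fintype V] (hT : T.IsTree) (o : V) :
    ∃ par : V → V, par o = o ∧
      (∀ v, v ≠ o → T.Adj v (par v) ∧ T.dist o (par v) + 1 = T.dist o v) ∧
      ∀ x : V → ℝ, T.lapForm x = ∑ v, (x v - x (par v)) ^ 2 := by
  choose f hf using fun v : {v // v ≠ o} => hT.exists_adj_dist_add_one_eq v.2
  set par : V → V := fun v => if h : v = o then o else f ⟨v, h⟩ with hpar
  have hp : ∀ v, v ≠ o → T.Adj v (par v) ∧ T.dist o (par v) + 1 = T.dist o v := by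
    intro v hv
    simp only [hpar, dif_neg hv]
    exact hf ⟨v, hv⟩
  have hpo : par o = o := by simp [hpar]
  refine ⟨par, hpo, hp, fun x => ?_⟩
  have hadj : ∀ v w, (if T.Adj v w then (x v - x w) ^ 2 else 0) =
      (if w = par v then (x v - x w) ^ 2 else 0) + (if v = par w then (x v - x w) ^ 2 else 0) := by
    intro v w
    have up : ∀ v w, w = par v → v ≠ w → T.Adj v w ∧ T.dist o w + 1 = T.dist o v := by
      intro v w h1 h2
      have h3 : v ≠ o := by
        rintro rfl
        exact h2 (by rw [h1, hpo])
      rw [h1]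
      exact hp v h3
    by_cases hvw : v = w
    · subst hvw; simp
    have down : ∀ v w, T.Adj v w → T.dist o v = T.dist o w + 1 → w = par v := by
      intro v w h1 h2
      have h3 : v ≠ o := by
        rintro rfl
        simp at h2
      exact hT.eq_of_adj_of_dist_add_one_eq h1.symm (hp v h3).1.symm h2.symm (hp v h3).2
    by_cases h1 : w = par v
    · have h2 := up v w h1 hvw
      have h3 : ¬ v = par w := fun h => by
        have := up w v h (Ne.symm hvw)
        omega
      rw [if_pos h2.1, if_pos h1, if_neg h3, add_zero]
    · by_cases h3 : v = par w
      · have h2 := up w v h3 (Ne.symm hvw)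
        rw [if_pos h2.1.symm, if_neg h1, if_pos h3, zero_add]
      · have h4 : ¬ T.Adj v w := fun h => by
          rcases hT.dist_eq_dist_add_one_of_adj o h with h5 | h5
          · exact h1 (down v w h h5)
          · exact h3 (down w v h.symm h5)
        rw [if_neg h1, if_neg h3, if_neg h4, add_zero]
  rw [lapForm_eq]
  simp_rw [hadj, Finset.sum_add_distrib]
  have h1 : ∑ v, ∑ w, (if w = par v then (x v - x w) ^ 2 else 0) =
      ∑ v, (x v - x (par v)) ^ 2 := by simp
  have h2 : ∑ v, ∑ w, (if v = par w then (x v - x w) ^ 2 else 0) =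
      ∑ v, (x v - x (par v)) ^ 2 := by
    rw [Finset.sum_comm]
    refine Finset.sum_congr rfl fun w _ => ?_
    rw [Finset.sum_ite_eq' Finset.univ (par w) (fun v => (x v - x w) ^ 2),
      if_pos (Finset.mem_univ _)]
    ring
  rw [h1, h2]
  ring

/-- A tree of diameter four has a vertex within distance two of all vertices, and two of its
neighbours are not leaves. -/
lemma IsTree.exists_center_of_diam_eq_four [Finite V] (hT : T.IsTree) (hd : T.diam = 4) :
    ∃ o a u b v, (∀ w, T.dist o w ≤ 2) ∧ a ≠ b ∧ T.Adj u a ∧ T.Adj v b ∧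
      T.dist o a = 1 ∧ T.dist o u = 2 ∧ T.dist o b = 1 ∧ T.dist o v = 2 := by
  have hne := hT.connected.nonempty
  have htop : T.ediam ≠ ⊤ := ediam_ne_top_of_diam_ne_zero (by omega)
  have hle : ∀ x y, T.dist x y ≤ 4 := fun x y => hd ▸ dist_le_diam htop
  obtain ⟨u, v, huv⟩ := T.exists_dist_eq_diam
  rw [hd] at huv
  have step : ∀ x y, T.dist x y ≠ 0 → ∃ a, T.Adj y a ∧ T.dist x a + 1 = T.dist x y :=
    fun x y h => hT.exists_adj_dist_add_one_eq (by rintro rfl; simp at h)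
  obtain ⟨b, hb, hdb⟩ := step u v (by omega)
  obtain ⟨o, ho, hdo⟩ := step u b (by omega)
  obtain ⟨a, ha, hda⟩ := step u o (by omega)
  have hau : T.Adj u a := dist_eq_one_iff_adj.1 (by omega)
  have hab : a ≠ b := by
    rintro rfl
    omega
  have hou : o ≠ u := by
    rintro rfl
    simp only [dist_self] at hda
    omega
  have hov : o ≠ v := by
    rintro rfl
    omega
  have far : ∀ w, 3 ≤ T.dist w o → ∀ a u, T.Adj o a → T.Adj u a → o ≠ u →
      T.dist w a + 1 = T.dist w o := by
    intro w hw a u hoa hua hou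
    rcases hT.dist_eq_dist_add_one_of_adj w hoa with h | h
    · exact h.symm
    · exfalso
      rcases hT.dist_eq_dist_add_one_of_adj w hua with h' | h'
      · have := hle w u
        omega
      · exact hou (hT.eq_of_adj_of_dist_add_one_eq hoa hua h.symm h'.symm)
  have hoa1 : T.dist o a = 1 := dist_eq_one_iff_adj.2 ha
  have hob1 : T.dist o b = 1 := dist_eq_one_iff_adj.2 ho.symm
  refine ⟨o, a, u, b, v, fun w => ?_, hab, hau, hb, hoa1, ?_, hob1, ?_⟩
  · by_contra hw
    rw [dist_comm] at hw
    exact hab (hT.eq_of_adj_of_dist_add_one_eq ha.symm ho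
      (far w (by omega) a u ha hau hou) (far w (by omega) b v ho.symm hb hov))
  · rw [dist_comm]
    omega
  · have h1 := hT.connected.dist_triangle (u := u) (v := o) (w := v)
    have h2 := hT.connected.dist_triangle (u := o) (v := b) (w := v)
    have h3 : T.dist b v = 1 := dist_eq_one_iff_adj.2 hb.symm
    omega

/-- The shape of a tree of diameter four: it is the tree of depth two with `r ≥ 2` branches of
sizes `1 ≤ s 0 ≤ s 1 ≤ …`. -/
theorem IsTree.exists_depthTwo_equiv [Fintype V] (hT : T.IsTree) (hd : T.diam = 4) :
    ∃ (r : ℕ) (s : Fin r → ℕ) (p : ℕ) (e : DepthTwoVertex s p ≃ V), 2 ≤ r ∧ Monotone s ∧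
      (∀ i, 1 ≤ s i) ∧ ∀ y, T.lapForm (y ∘ e.symm) = DepthTwoVertex.form y := by
  classical
  obtain ⟨o, a, u, b, v, hle, hab, hua, hvb, hoa, hou, hob, hov⟩ :=
    hT.exists_center_of_diam_eq_four hd
  obtain ⟨par, hpo, hpar, hform⟩ := hT.exists_parent o
  have hpp : ∀ w, par (par w) = o := by
    intro w
    by_contra h
    have h1 : par w ≠ o := by
      intro h'
      rw [h', hpo] at h
      exact h rfl
    have h2 : w ≠ o := by
      rintro rfl
      exact h1 hpo
    have h3 := (hpar _ h1).2
    have h4 := (hpar _ h2).2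
    have h5 := hle w
    have h6 := hT.connected.dist_eq_zero_iff.not.2 (Ne.symm h)
    omega
  have hpu : ∀ a u, T.Adj u a → T.dist o a = 1 → T.dist o u = 2 → par u = a := by
    intro a u hua ha hu
    have h1 : u ≠ o := by
      rintro rfl
      simp at hu
    exact hT.eq_of_adj_of_dist_add_one_eq (hpar u h1).1.symm hua.symm (hpar u h1).2 (by omega)
  -- `B` are the hubs, `Q` the leaves at the root, and `F c` the leaves of the hub `c`.
  let B := {c : V // c ≠ o ∧ ∃ l, par l = c}
  let Q := {q : V // q ≠ o ∧ par q = o ∧ ∀ l, par l ≠ q}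
  let F : B → Type _ := fun c => {l : V // par l = c}
  have hB : ∀ c : B, par c.1 = o := by
    rintro ⟨c, hc, l, rfl⟩
    exact hpp l
  let f0 : Fin (Fintype.card B) ≃ B := (Fintype.equivFin B).symm
  -- The hubs are enumerated by increasing number of leaves.
  let σ := Tuple.sort fun i => Fintype.card (F (f0 i))
  let f : Fin (Fintype.card B) ≃ B := σ.trans f0
  let s : Fin (Fintype.card B) → ℕ := fun i => Fintype.card (F (f i))
  let g : ∀ i, Fin (s i) ≃ F (f i) := fun i => (Fintype.equivFin (F (f i))).symm
  let h : Fin (Fintype.card Q) ≃ Q := (Fintype.equivFin Q).symm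
  let e0 : DepthTwoVertex s (Fintype.card Q) → V := fun m =>
    match m with
    | Sum.inl _ => o
    | Sum.inr (Sum.inl ⟨i, none⟩) => (f i).1
    | Sum.inr (Sum.inl ⟨i, some j⟩) => (g i j).1
    | Sum.inr (Sum.inr k) => (h k).1
  have hg : ∀ i j, par (g i j).1 = (f i).1 := fun i j => (g i j).2
  have hgo : ∀ i j, (g i j).1 ≠ o := by
    intro i j h
    have h1 := hg i j
    rw [h, hpo] at h1
    exact (f i).2.1 h1.symm
  have hbij : Function.Bijective e0 := by
    constructor
    · rintro (⟨⟩ | ⟨i, _ | j⟩ | k) (⟨⟩ | ⟨i', _ | j'⟩ | k') h1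
      · rfl
      · exact absurd h1.symm (f i').2.1
      · exact absurd h1.symm (hgo i' j')
      · exact absurd h1.symm (h k').2.1
      · exact absurd h1 (f i).2.1
      · have : i = i' := f.injective (Subtype.ext h1)
        rw [this]
      · exfalso
        have h2 : (f i).1 = (g i' j').1 := h1
        have h3 := hg i' j'
        rw [← h2, hB] at h3
        exact (f i').2.1 h3.symm
      · exfalso
        obtain ⟨l, hl⟩ := (f i).2.2
        exact (h k').2.2.2 l (hl.trans h1)
      · exact absurd h1 (hgo i j)
      · exfalso
        have h2 : (g i j).1 = (f i').1 := h1
        have h3 := hg i j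
        rw [h2, hB] at h3
        exact (f i).2.1 h3.symm
      · have h2 : (g i j).1 = (g i' j').1 := h1
        have h3 : i = i' := f.injective (Subtype.ext (by rw [← hg i j, ← hg i' j', h2]))
        subst h3
        have h4 : j = j' := (g i).injective (Subtype.ext h2)
        rw [h4]
      · exfalso
        have h2 : (g i j).1 = (h k').1 := h1
        have h3 := hg i j
        rw [h2, (h k').2.2.1] at h3
        exact (f i).2.1 h3.symm
      · exact absurd h1 (h k).2.1
      · exfalso
        obtain ⟨l, hl⟩ := (f i').2.2
        exact (h k).2.2.2 l (hl.trans h1.symm)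
      · exfalso
        have h2 : (h k).1 = (g i' j').1 := h1
        have h3 := hg i' j'
        rw [← h2, (h k).2.2.1] at h3
        exact (f i').2.1 h3.symm
      · have : k = k' := h.injective (Subtype.ext h1)
        rw [this]
    · intro w
      by_cases hw : w = o
      · exact ⟨Sum.inl (), hw.symm⟩
      by_cases hc : ∃ l, par l = w
      · refine ⟨Sum.inr (Sum.inl ⟨f.symm ⟨w, hw, hc⟩, none⟩), ?_⟩
        change (f (f.symm ⟨w, hw, hc⟩)).1 = w
        rw [Equiv.apply_symm_apply]
      push Not at hc
      by_cases hpw : par w = o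
      · refine ⟨Sum.inr (Sum.inr (h.symm ⟨w, hw, hpw, hc⟩)), ?_⟩
        change (h (h.symm ⟨w, hw, hpw, hc⟩)).1 = w
        rw [Equiv.apply_symm_apply]
      · let i := f.symm ⟨par w, hpw, w, rfl⟩
        have hi : par w = (f i).1 := by
          change par w = (f (f.symm ⟨par w, hpw, w, rfl⟩)).1
          rw [Equiv.apply_symm_apply]
        refine ⟨Sum.inr (Sum.inl ⟨i, some ((g i).symm ⟨w, hi⟩)⟩), ?_⟩
        exact congrArg Subtype.val ((g i).apply_symm_apply ⟨w, hi⟩)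
  let e := Equiv.ofBijective e0 hbij
  refine ⟨Fintype.card B, s, Fintype.card Q, e, ?_, ?_, ?_, fun y => ?_⟩
  · have ha : a ≠ o := by
      rintro rfl
      simp at hoa
    have hb : b ≠ o := by
      rintro rfl
      simp at hob
    have h1 : 1 < Fintype.card B := Fintype.one_lt_card_iff.2
      ⟨⟨a, ha, u, hpu a u hua hoa hou⟩, ⟨b, hb, v, hpu b v hvb hob hov⟩,
        fun h => hab (congrArg Subtype.val h)⟩
    exact h1
  · exact Tuple.monotone_sort fun i => Fintype.card (F (f0 i))
  · intro i
    obtain ⟨l, hl⟩ := (f i).2.2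
    exact Fintype.card_pos_iff.2 ⟨⟨l, hl⟩⟩
  · have he : ∀ m, e m = e0 m := fun _ => rfl
    have hz : ∀ m, (y ∘ e.symm) (e0 m) = y m := by
      intro m
      rw [← he, Function.comp_apply, Equiv.symm_apply_apply]
    rw [hform, ← Equiv.sum_comp e, DepthTwoVertex.sum_eq, DepthTwoVertex.form]
    have h0 : e0 (Sum.inl ()) = o := rfl
    have r1 : par (e0 (Sum.inl ())) = e0 (Sum.inl ()) := hpo
    have r2 : ∀ i, par (e0 (DepthTwoVertex.hub i)) = e0 (Sum.inl ()) := fun i => hB (f i)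
    have r3 : ∀ i j, par (e0 (DepthTwoVertex.leaf i j)) = e0 (DepthTwoVertex.hub i) :=
      fun i j => hg i j
    have r4 : ∀ k, par (e0 (DepthTwoVertex.pendant k)) = e0 (Sum.inl ()) := fun k => (h k).2.2.1
    simp only [he, r1, r2, r3, r4, hz]
    rw [sub_self, zero_pow two_ne_zero, zero_add]
    congr 1
    · refine Finset.sum_congr rfl fun i _ => ?_
      congr 1
      · ring
      · exact Finset.sum_congr rfl fun j _ => by ring
    · exact Finset.sum_congr rfl fun k _ => by ring

end SimpleGraph

/-! ### The energies of the star and the path -/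

namespace SimpleGraph

variable {V : Type*} [Fintype V] {G : SimpleGraph V}

lemma IsTree.averageDegree_eq (hG : G.IsTree) :
    G.averageDegree = 2 - 2 / (Fintype.card V : ℝ) := by
  classical
  have h1 := hG.card_edgeFinset
  have h2 : G.edgeSet.ncard = G.edgeFinset.card := by
    rw [← coe_edgeFinset, Set.ncard_coe_finset]
  have h3 : (G.edgeSet.ncard : ℝ) + 1 = Fintype.card V := by
    rw [h2]; exact_mod_cast h1
  have h4 : (Fintype.card V : ℝ) ≠ 0 := by
    rw [← h3]; positivity
  rw [averageDegree, eq_sub_iff_add_eq, ← add_div, div_eq_iff h4, ← h3]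
  ring

/-- The number of vertices is an eigenvalue of the Laplacian of a star. -/
theorem le_laplacianEnergy_starGraph (c : V) (hV : 2 ≤ Fintype.card V) :
    2 * ((Fintype.card V : ℝ) - (2 - 2 / (Fintype.card V : ℝ))) ≤
      (starGraph c).laplacianEnergy := by
  classical
  set n : ℝ := (Fintype.card V : ℝ) with hn
  have hn2 : 2 ≤ n := by rw [hn]; exact_mod_cast hV
  have hT := isTree_starGraph c
  obtain ⟨par, hpc, hpar, hform⟩ := hT.exists_parent c
  have hp : ∀ v, par v = c := by
    intro v
    by_cases hv : v = c
    · rw [hv, hpc]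
    · rcases (starGraph_adj.1 (hpar v hv).1).2 with h | h
      · exact absurd h hv
      · exact h
  set u : V → ℝ := fun v => if v = c then n - 1 else -1 with hu
  have hN : ∑ v, u v ^ 2 = n * (n - 1) := by
    rw [← Finset.add_sum_erase _ _ (Finset.mem_univ c),
      Finset.sum_congr rfl (g := fun _ => (1 : ℝ))
        (fun v hv => by simp [hu, Finset.ne_of_mem_erase hv]),
      Finset.sum_const, Finset.card_erase_of_mem (Finset.mem_univ c), Finset.card_univ,
      nsmul_eq_mul, Nat.cast_sub (by omega)]
    simp only [hu, if_true]
    push_cast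
    ring
  have hQ : (starGraph c).lapForm u = n * (n * (n - 1)) := by
    rw [hform, ← Finset.add_sum_erase _ _ (Finset.mem_univ c),
      Finset.sum_congr rfl (g := fun _ => n ^ 2)
        (fun v hv => by
          simp only [hp, hu, Finset.ne_of_mem_erase hv, if_true, if_false]
          ring),
      Finset.sum_const, Finset.card_erase_of_mem (Finset.mem_univ c), Finset.card_univ,
      nsmul_eq_mul, Nat.cast_sub (by omega), hp]
    push_cast
    ring
  have hpos : 0 < n * (n - 1) := mul_pos (by linarith) (by linarith)
  have h := (starGraph c).le_laplacianEnergy_of_orthogonal (Equiv.refl V) (fun _ : Unit => u)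
    (fun i j hij => absurd rfl hij) (fun _ => by rw [hN]; exact hpos)
  simp only [Finset.univ_unique, Finset.sum_singleton, Equiv.refl_symm, Equiv.coe_refl,
    Function.comp_id] at h
  rwa [hN, hQ, mul_div_assoc, div_self hpos.ne', mul_one, hT.averageDegree_eq] at h

open Classical in
lemma lapMatrix_mulVec_eq_sum_ite (G : SimpleGraph V) (x : V → ℝ) (v : V) :
    (G.lapMatrix ℝ).mulVec x v = ∑ w, if G.Adj v w then x v - x w else 0 := by
  rw [lapMatrix_mulVec_apply, ← Finset.sum_filter, Finset.sum_sub_distrib, Finset.sum_const,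
    nsmul_eq_mul, ← card_neighborFinset_eq_degree, neighborFinset_eq_filter]

open Classical in
lemma exists_eigenvalues_eq (G : SimpleGraph V) {x : V → ℝ} {μ : ℝ} (hx : x ≠ 0)
    (h : ∀ v, ∑ w, (if G.Adj v w then x v - x w else 0) = μ * x v) :
    ∃ i, (G.isHermitian_lapMatrix ℝ).eigenvalues i = μ := by
  have h1 : (G.lapMatrix ℝ).mulVec x = μ • x := by
    ext v
    rw [lapMatrix_mulVec_eq_sum_ite, h]
    rfl
  have h2 : Module.End.HasEigenvalue (Matrix.toLin' (G.lapMatrix ℝ)) μ :=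
    Module.End.hasEigenvalue_of_hasEigenvector
      ⟨Module.End.mem_eigenspace_iff.2 (by rw [Matrix.toLin'_apply, h1]), hx⟩
  have h3 := Module.End.hasEigenvalue_iff_mem_spectrum.1 h2
  rw [Matrix.spectrum_toLin', (G.isHermitian_lapMatrix ℝ).spectrum_real_eq_range_eigenvalues] at h3
  exact h3

open Classical in
/-- If the distinct numbers `μ v`, one for each vertex, are Laplacian eigenvalues, then they are all
of them. -/
lemma sum_comp_eigenvalues_eq (G : SimpleGraph V) {μ : V → ℝ} (hμ : Function.Injective μ)
    (h : ∀ v, ∃ i, (G.isHermitian_lapMatrix ℝ).eigenvalues i = μ v) (g : ℝ → ℝ) :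
    ∑ i, g ((G.isHermitian_lapMatrix ℝ).eigenvalues i) = ∑ v, g (μ v) := by
  choose σ hσ using h
  have hinj : Function.Injective σ := fun a b hab => hμ (by rw [← hσ a, ← hσ b, hab])
  have hbij : Function.Bijective σ := Finite.injective_iff_bijective.1 hinj
  rw [← Equiv.sum_comp (Equiv.ofBijective σ hbij)]
  exact Finset.sum_congr rfl fun v _ => by rw [Equiv.ofBijective_apply, hσ]

open Classical in
/-- The Laplacian energy and the number of edges in terms of eigenvectors `x v`, one for each vertex,
with distinct eigenvalues `μ v`. -/
lemma laplacianEnergy_eq_of_eigenvectors (G : SimpleGraph V) {μ : V → ℝ} {x : V → V → ℝ}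
    (hμ : Function.Injective μ) (hx : ∀ j, x j ≠ 0)
    (h : ∀ j v, ∑ w, (if G.Adj v w then x j v - x j w else 0) = μ j * x j v) :
    G.laplacianEnergy = ∑ j, |μ j - G.averageDegree| ∧
      2 * (G.edgeSet.ncard : ℝ) = ∑ j, μ j := by
  have h1 := fun j => G.exists_eigenvalues_eq (hx j) (h j)
  exact ⟨G.sum_comp_eigenvalues_eq hμ h1 fun t => |t - G.averageDegree|, by
    rw [← sum_eigenvalues_eq_two_mul_edges]
    exact G.sum_comp_eigenvalues_eq hμ h1 fun t => t⟩

open Classical in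
/-- The vector `v ↦ cos ((2v + 1) φ)` with `φ = j π / (2n)` is an eigenvector of the path. -/
lemma pathGraph_eigenvector {n : ℕ} (j : Fin n) (v : Fin n) (φ : ℝ)
    (hφ : 2 * n * φ = j * Real.pi) :
    ∑ w, (if (pathGraph n).Adj v w then
      Real.cos ((2 * (v : ℕ) + 1) * φ) - Real.cos ((2 * (w : ℕ) + 1) * φ) else 0) =
    (2 - 2 * Real.cos (2 * φ)) * Real.cos ((2 * (v : ℕ) + 1) * φ) := by
  set a := (2 * (v : ℕ) + 1) * φ with ha
  have hsplit : ∀ w : Fin n, (if (pathGraph n).Adj v w then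
      Real.cos a - Real.cos ((2 * (w : ℕ) + 1) * φ) else 0) =
      (if (v : ℕ) + 1 = w then Real.cos a - Real.cos (a + 2 * φ) else 0) +
        (if (w : ℕ) + 1 = v then Real.cos a - Real.cos (a - 2 * φ) else 0) := by
    intro w
    rw [pathGraph_adj]
    by_cases h1 : (v : ℕ) + 1 = w
    · have h2 : ¬ (w : ℕ) + 1 = v := by omega
      rw [if_pos (Or.inl h1), if_pos h1, if_neg h2, add_zero, ← h1]
      congr 2
      push_cast
      rw [ha]
      ring
    · by_cases h2 : (w : ℕ) + 1 = v
      · rw [if_pos (Or.inr h2), if_neg h1, if_pos h2, zero_add]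
        congr 2
        rw [ha, ← h2]
        push_cast
        ring
      · rw [if_neg (by tauto), if_neg h1, if_neg h2, add_zero]
  -- At the ends of the path the cosine is symmetric about the missing edge.
  have hup : ∑ w : Fin n, (if (v : ℕ) + 1 = w then Real.cos a - Real.cos (a + 2 * φ) else 0) =
      Real.cos a - Real.cos (a + 2 * φ) := by
    by_cases hv : (v : ℕ) + 1 < n
    · rw [Finset.sum_eq_single ⟨(v : ℕ) + 1, hv⟩]
      · simp
      · intro w _ hw
        exact if_neg fun h => hw (Fin.ext h.symm)
      · simp
    · have hvn : (v : ℕ) + 1 = n := by omega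
      have hvn' : ((v : ℕ) : ℝ) + 1 = n := by exact_mod_cast hvn
      have h1 : a = (j : ℕ) * Real.pi - φ := by
        rw [ha, ← hφ, ← hvn']; ring
      have h2 : a + 2 * φ = (j : ℕ) * Real.pi + φ := by rw [h1]; ring
      rw [h2, h1, Real.cos_sub, Real.cos_add, Real.sin_nat_mul_pi]
      simp
  have hdown : ∑ w : Fin n, (if (w : ℕ) + 1 = v then Real.cos a - Real.cos (a - 2 * φ) else 0) =
      Real.cos a - Real.cos (a - 2 * φ) := by
    by_cases hv : 0 < (v : ℕ)
    · rw [Finset.sum_eq_single ⟨(v : ℕ) - 1, by omega⟩]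
      · simp [Nat.sub_add_cancel hv]
      · intro w _ hw
        refine if_neg fun h => hw (Fin.ext ?_)
        change (w : ℕ) = (v : ℕ) - 1
        omega
      · simp
    · have hv0 : (v : ℕ) = 0 := by omega
      have h1 : a = φ := by rw [ha, hv0]; push_cast; ring
      have h2 : a - 2 * φ = -φ := by rw [h1]; ring
      rw [h2, h1, Real.cos_neg]
      simp
  rw [Finset.sum_congr rfl fun w _ => hsplit w, Finset.sum_add_distrib, hup, hdown, Real.cos_add,
    Real.cos_sub]
  ring

/-- The Dirichlet kernel. -/
lemma sum_range_two_mul_cos_mul_sin (x : ℝ) (m : ℕ) :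
    (∑ j ∈ Finset.range m, 2 * Real.cos (2 * (j * x))) * Real.sin x =
      Real.sin x + Real.sin ((2 * m - 1) * x) := by
  induction m with
  | zero => simp
  | succ m ih =>
    rw [Finset.sum_range_succ, add_mul, ih]
    have h1 : (2 * (m : ℝ) - 1) * x = 2 * (m * x) - x := by ring
    have h2 : (2 * ((m + 1 : ℕ) : ℝ) - 1) * x = 2 * (m * x) + x := by push_cast; ring
    rw [h1, h2, Real.sin_sub, Real.sin_add]
    ring

/-- The Laplacian spectrum of the path: its energy and its number of edges. -/
lemma laplacianEnergy_pathGraph_eq {n : ℕ} (hn : 2 ≤ n) :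
    (pathGraph n).laplacianEnergy =
      ∑ j ∈ Finset.range n, |2 - 2 * Real.cos (2 * (j * (Real.pi / (2 * n)))) -
        (pathGraph n).averageDegree| ∧
    2 * ((pathGraph n).edgeSet.ncard : ℝ) =
      ∑ j ∈ Finset.range n, (2 - 2 * Real.cos (2 * (j * (Real.pi / (2 * n))))) := by
  have hn0 : (0 : ℝ) < n := by exact_mod_cast (by omega : 0 < n)
  have hx : 0 < Real.pi / (2 * n) := by positivity
  have key : ∀ j : Fin n, 2 * n * ((j : ℕ) * (Real.pi / (2 * n))) = (j : ℕ) * Real.pi := by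
    intro j; field_simp
  rw [← Fin.sum_univ_eq_sum_range
    (fun j => |2 - 2 * Real.cos (2 * (j * (Real.pi / (2 * n)))) - (pathGraph n).averageDegree|) n,
    ← Fin.sum_univ_eq_sum_range
      (fun j => 2 - 2 * Real.cos (2 * (j * (Real.pi / (2 * n))))) n]
  refine (pathGraph n).laplacianEnergy_eq_of_eigenvectors
    (x := fun j v : Fin n => Real.cos ((2 * (v : ℕ) + 1) * ((j : ℕ) * (Real.pi / (2 * n))))) ?_ ?_
    (fun j v => pathGraph_eigenvector j v _ (key j))
  · intro i j hij
    have h1 : ∀ j : Fin n, 2 * ((j : ℕ) * (Real.pi / (2 * n))) ∈ Set.Icc 0 Real.pi := by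
      intro j
      refine ⟨by positivity, ?_⟩
      have hj : ((j : ℕ) : ℝ) ≤ n := by exact_mod_cast j.2.le
      have : 2 * ((j : ℕ) * (Real.pi / (2 * n))) = (j : ℕ) / n * Real.pi := by field_simp
      rw [this]
      exact mul_le_of_le_one_left Real.pi_pos.le ((div_le_one hn0).2 hj)
    have h2 : Real.cos (2 * ((i : ℕ) * (Real.pi / (2 * n)))) =
        Real.cos (2 * ((j : ℕ) * (Real.pi / (2 * n)))) := by
      simp only at hij
      linarith
    have h3 := Real.injOn_cos (h1 i) (h1 j) h2
    have h4 : ((i : ℕ) : ℝ) = (j : ℕ) := by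
      have := mul_right_cancel₀ hx.ne' (mul_left_cancel₀ two_ne_zero h3)
      exact this
    exact Fin.ext (by exact_mod_cast h4)
  · intro j h
    have h0 := congrFun h ⟨0, by omega⟩
    have h1 : (0 : ℝ) < Real.cos ((2 * ((0 : ℕ) : ℝ) + 1) *
        ((j : ℕ) * (Real.pi / (2 * n)))) := by
      have hj : ((j : ℕ) : ℝ) < n := by exact_mod_cast j.2
      have h2 : (2 * ((0 : ℕ) : ℝ) + 1) * ((j : ℕ) * (Real.pi / (2 * n))) =
          (j : ℕ) / n * (Real.pi / 2) := by field_simp; push_cast; ring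
      rw [h2]
      refine Real.cos_pos_of_mem_Ioo ⟨?_, ?_⟩
      · have : 0 ≤ (j : ℕ) / (n : ℝ) * (Real.pi / 2) := by positivity
        linarith [Real.pi_pos]
      · exact mul_lt_of_lt_one_left (by positivity) ((div_lt_one hn0).2 hj)
    exact h1.ne' h0

lemma averageDegree_pathGraph {n : ℕ} (hn : 2 ≤ n) :
    (pathGraph n).averageDegree = 2 - 2 / (n : ℝ) := by
  classical
  have hn0 : (0 : ℝ) < n := by exact_mod_cast (by omega : 0 < n)
  have h2 := (laplacianEnergy_pathGraph_eq hn).2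
  have hx : 0 < Real.pi / (2 * n) := by positivity
  have h3 := sum_range_two_mul_cos_mul_sin (Real.pi / (2 * n)) n
  have h4 : (2 * (n : ℝ) - 1) * (Real.pi / (2 * n)) = Real.pi - Real.pi / (2 * n) := by
    field_simp
  have hsin : 0 < Real.sin (Real.pi / (2 * n)) := by
    refine Real.sin_pos_of_pos_of_lt_pi hx ?_
    refine div_lt_self Real.pi_pos ?_
    have : (2 : ℝ) ≤ n := by exact_mod_cast hn
    linarith
  rw [h4, Real.sin_pi_sub, ← two_mul] at h3
  have h5 := mul_right_cancel₀ hsin.ne' h3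
  rw [Finset.sum_sub_distrib, h5, Finset.sum_const, Finset.card_range, nsmul_eq_mul] at h2
  rw [averageDegree, h2, Fintype.card_fin]
  field_simp

/-- The energy of the path is twice `cot x` for even `n` and twice `1 / sin x - 1 / n` for odd `n`,
where `x = π / (2n)`; either is at most `2 / x`. -/
theorem laplacianEnergy_pathGraph_le {n : ℕ} (hn : 2 ≤ n) :
    (pathGraph n).laplacianEnergy ≤ 4 * n / Real.pi := by
  classical
  have hn0 : (0 : ℝ) < n := by exact_mod_cast (by omega : 0 < n)
  have hn2 : (2 : ℝ) ≤ n := by exact_mod_cast hn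
  set x := Real.pi / (2 * n) with hx
  have hxpos : 0 < x := by positivity
  have hnx : n * x = Real.pi / 2 := by rw [hx]; field_simp
  have hx1 : x < 1 := by
    have h1 : 2 * x ≤ n * x := mul_le_mul_of_nonneg_right hn2 hxpos.le
    have := Real.pi_lt_four
    linarith
  have hxpi : x < Real.pi / 2 := by
    have := Real.pi_gt_three
    linarith
  have hsin : 0 < Real.sin x := Real.sin_pos_of_pos_of_lt_pi hxpos (by linarith)
  set a : ℕ → ℝ := fun j => 2 * Real.cos (2 * (j * x)) - 2 / n with ha
  have hE : (pathGraph n).laplacianEnergy = ∑ j ∈ Finset.range n, |a j| := by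
    rw [(laplacianEnergy_pathGraph_eq hn).1]
    refine Finset.sum_congr rfl fun j _ => ?_
    rw [averageDegree_pathGraph hn, ← abs_neg]
    congr 1
    simp only [ha, hx]
    ring
  have hsum : ∀ m : ℕ, ∑ j ∈ Finset.range m, a j =
      1 + Real.sin ((2 * m - 1) * x) / Real.sin x - 2 * m / n := by
    intro m
    have h := sum_range_two_mul_cos_mul_sin x m
    rw [Finset.sum_sub_distrib, Finset.sum_const, Finset.card_range, nsmul_eq_mul,
      eq_div_of_mul_eq hsin.ne' h, add_div, div_self hsin.ne']
    ring
  have hsin_last : Real.sin ((2 * n - 1) * x) = Real.sin x := by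
    have : (2 * n - 1) * x = Real.pi - x := by linear_combination 2 * hnx
    rw [this, Real.sin_pi_sub]
  have htot : ∑ j ∈ Finset.range n, a j = 0 := by
    rw [hsum, hsin_last, div_self hsin.ne']
    field_simp
    ring
  -- `m` is the number of `j` with `2 * j < n`, which are those with `0 ≤ a j`.
  set m := (n + 1) / 2 with hm
  have hmn : m ≤ n := by omega
  have hpos : ∀ j ∈ Finset.range m, 0 ≤ a j := by
    intro j hj
    rw [Finset.mem_range] at hj
    have hj' : (2 * (j : ℝ)) + 1 ≤ n := by exact_mod_cast (by omega : 2 * j + 1 ≤ n)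
    have h1 : x ≤ Real.pi / 2 - 2 * (j * x) := by
      rw [← hnx]
      nlinarith
    have h2 : Real.sin x ≤ Real.cos (2 * (j * x)) := by
      rw [← Real.sin_pi_div_two_sub]
      refine Real.sin_le_sin_of_le_of_le_pi_div_two (by linarith) ?_ h1
      have : 0 ≤ (j : ℝ) * x := by positivity
      linarith
    have h3 := Real.mul_le_sin hxpos.le hxpi.le
    have h4 : 2 / Real.pi * x = 1 / n := by
      rw [hx]
      have := Real.pi_pos
      field_simp
    have h5 : 2 / (n : ℝ) = 2 * (1 / n) := by ring
    simp only [ha]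
    rw [h5, ← h4]
    linarith
  have hneg : ∀ j ∈ Finset.Ico m n, a j ≤ 0 := by
    intro j hj
    rw [Finset.mem_Ico] at hj
    have hj1 : (n : ℝ) ≤ 2 * j := by exact_mod_cast (by omega : n ≤ 2 * j)
    have hj2 : (j : ℝ) ≤ n := by exact_mod_cast hj.2.le
    have h1 : Real.cos (2 * (j * x)) ≤ 0 := by
      refine Real.cos_nonpos_of_pi_div_two_le_of_le ?_ ?_
      · rw [← hnx]
        nlinarith
      · have h2 : (j : ℝ) * x ≤ n * x := mul_le_mul_of_nonneg_right hj2 hxpos.le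
        have := Real.pi_pos
        linarith
    have h2 : (0 : ℝ) ≤ 2 / n := by positivity
    simp only [ha]
    linarith
  have hE2 : (pathGraph n).laplacianEnergy = 2 * ∑ j ∈ Finset.range m, a j := by
    rw [hE]
    have h1 : ∑ j ∈ Finset.range n, |a j| =
        ∑ j ∈ Finset.range m, |a j| + ∑ j ∈ Finset.Ico m n, |a j| :=
      (Finset.sum_range_add_sum_Ico _ hmn).symm
    have h2 : ∑ j ∈ Finset.range n, a j =
        ∑ j ∈ Finset.range m, a j + ∑ j ∈ Finset.Ico m n, a j :=
      (Finset.sum_range_add_sum_Ico _ hmn).symm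
    rw [h1, Finset.sum_congr rfl fun j hj => abs_of_nonneg (hpos j hj),
      Finset.sum_congr rfl fun j hj => abs_of_nonpos (hneg j hj), Finset.sum_neg_distrib]
    linarith
  have hgoal : 4 * n / Real.pi = 2 * (1 / x) := by
    rw [hx]
    have := Real.pi_pos
    field_simp
    ring
  rw [hE2, hsum, hgoal]
  refine mul_le_mul_of_nonneg_left ?_ (by norm_num)
  rcases Nat.even_or_odd' n with ⟨k, hk | hk⟩
  · have hmk : 2 * m = n := by omega
    have hmk' : 2 * (m : ℝ) = n := by exact_mod_cast hmk
    have h1 : Real.sin ((2 * m - 1) * x) = Real.cos x := by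
      rw [hmk', ← Real.sin_pi_div_two_sub, ← hnx]
      ring_nf
    have h2 := Real.le_tan hxpos.le hxpi
    rw [Real.tan_eq_sin_div_cos, le_div_iff₀ (Real.cos_pos_of_mem_Ioo ⟨by linarith, hxpi⟩)] at h2
    rw [h1, hmk', div_self hn0.ne', add_sub_cancel_left, div_le_div_iff₀ hsin hxpos]
    linarith
  · have hmk : 2 * m = n + 1 := by omega
    have hmk' : 2 * (m : ℝ) = n + 1 := by exact_mod_cast hmk
    have h1 : Real.sin ((2 * m - 1) * x) = 1 := by
      rw [hmk', add_sub_cancel_right, hnx, Real.sin_pi_div_two]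
    have hn1 : 1 / (n : ℝ) = 2 * x / Real.pi := by
      rw [hx]
      have := Real.pi_pos
      field_simp
    have h2 := Real.sin_gt_sub_cube hxpos
    have hpi : 1 / 2 ≤ 2 / Real.pi := by
      rw [div_le_div_iff₀ (by norm_num) Real.pi_pos]
      linarith [Real.pi_lt_four]
    have h3 : 1 / Real.sin x ≤ 1 / x + x / 2 := by
      rw [div_add_div _ _ hxpos.ne' two_ne_zero, div_le_div_iff₀ hsin (by positivity)]
      have h4 : x - x ^ 3 / 6 ≤ Real.sin x := h2.le
      have h5 : (0 : ℝ) ≤ 1 * 2 + x * x := by positivity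
      have h6 := mul_le_mul_of_nonneg_left h4 h5
      have h7 : x ^ 2 ≤ 1 := by nlinarith
      have h8 : 0 ≤ x ^ 3 * (4 - x ^ 2) := by
        have : 0 < x ^ 3 := by positivity
        exact mul_nonneg this.le (by linarith)
      linarith
    have h4 : 2 * x / Real.pi = x * (2 / Real.pi) := by ring
    have h5 : x * (1 / 2) ≤ x * (2 / Real.pi) := mul_le_mul_of_nonneg_left hpi hxpos.le
    have h6 : 2 * (m : ℝ) / n = 1 + 1 / n := by
      rw [hmk', add_div, div_self hn0.ne']
    rw [h1, h6, hn1, h4]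
    linarith

end SimpleGraph

/-! ### Vectors constant on the leaves of each branch -/

namespace DepthTwoVertex

variable {r : ℕ} {s : Fin r → ℕ} {p : ℕ}

/-- The vector with value `α` at the root, `β i` at the hub of the branch `i`, `γ i` at its leaves,
and `δ` at the leaves of the root. -/
def levelVec (α : ℝ) (β γ : Fin r → ℝ) (δ : ℝ) : DepthTwoVertex s p → ℝ
  | Sum.inl _ => α
  | Sum.inr (Sum.inl ⟨i, none⟩) => β i
  | Sum.inr (Sum.inl ⟨i, some _⟩) => γ i
  | Sum.inr (Sum.inr _) => δ

lemma sum_levelVec_mul (α : ℝ) (β γ : Fin r → ℝ) (δ : ℝ) (y : DepthTwoVertex s p → ℝ) :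
    ∑ m, levelVec α β γ δ m * y m = α * y root +
      ((∑ i, (β i * y (hub i) + γ i * ∑ j, y (leaf i j))) + δ * ∑ k, y (pendant k)) := by
  rw [sum_eq]
  simp [levelVec, Finset.mul_sum]

lemma sum_levelVec_mul_levelVec (α α' : ℝ) (β β' γ γ' : Fin r → ℝ) (δ δ' : ℝ) :
    ∑ m, (levelVec α β γ δ : DepthTwoVertex s p → ℝ) m * levelVec α' β' γ' δ' m =
      α * α' + ((∑ i, (β i * β' i + s i * (γ i * γ' i))) + p * (δ * δ')) := by
  rw [sum_eq]
  simp [levelVec]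

lemma sum_levelVec_sq (α : ℝ) (β γ : Fin r → ℝ) (δ : ℝ) :
    ∑ m, (levelVec α β γ δ : DepthTwoVertex s p → ℝ) m ^ 2 =
      α ^ 2 + ((∑ i, (β i ^ 2 + s i * γ i ^ 2)) + p * δ ^ 2) := by
  simp_rw [sq]
  exact sum_levelVec_mul_levelVec _ _ _ _ _ _ _ _

lemma form_levelVec (α : ℝ) (β γ : Fin r → ℝ) (δ : ℝ) :
    form (levelVec α β γ δ : DepthTwoVertex s p → ℝ) =
      (∑ i, ((α - β i) ^ 2 + s i * (β i - γ i) ^ 2)) + p * (α - δ) ^ 2 := by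
  simp [form, levelVec]

end DepthTwoVertex

/-! ### The upper bound -/

/-- In the coordinates of a branch with `s` leaves, `v` the entry at the hub, `S` and `L` the sum and
the sum of squares of the entries at the leaves: the form of the branch, including the diagonal
contribution of the edge to the root, is at most `c` plus a multiple of the square of the linear
form given by an eigenvector for the larger root `t`. -/
lemma branch_form_le {s t c v S L : ℝ} (ht : t ^ 2 = (s + 2) * t - 1) (ht1 : 1 < t) (hs : 0 < s)
    (hc : 1 ≤ c) (hS : S ^ 2 ≤ s * L) :
    (s + 1) * v ^ 2 - 2 * v * S + L ≤
      c * (v ^ 2 + L) + (t - c) / (s * (t + 1)) * ((t - 1) * v - S) ^ 2 := by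
  have ht0 : t ≠ 0 := by linarith
  have hst : (t - 1) ^ 2 = s * t := by linarith
  set N := s * (t + 1) with hN
  have hNpos : 0 < N := mul_pos hs (by linarith)
  have h1 : N * (s * v ^ 2 - 2 * v * S) ≤ (t - 1) * ((t - 1) * v - S) ^ 2 := by
    have h2 : (t - 1) * ((t - 1) * v - S) ^ 2 - N * (s * v ^ 2 - 2 * v * S) =
        (t - 1) * ((t - 1) / t * v + S) ^ 2 := by
      have h3 : s = (t - 1) ^ 2 / t := by rw [hst]; field_simp
      rw [hN, h3]
      field_simp
      ring
    have h4 : 0 ≤ (t - 1) * ((t - 1) / t * v + S) ^ 2 :=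
      mul_nonneg (by linarith) (sq_nonneg _)
    linarith
  have h5 : ((t - 1) * v - S) ^ 2 ≤ N * (v ^ 2 + L) := by
    have h6 : 0 ≤ (s * v + (t - 1) * S) ^ 2 := sq_nonneg _
    have h7 : N * S ^ 2 ≤ N * (s * L) := mul_le_mul_of_nonneg_left hS hNpos.le
    have h8 : s * ((t - 1) * v - S) ^ 2 ≤ s * (N * (v ^ 2 + L)) := by
      have h9 : s * (N * v ^ 2) + N * S ^ 2 - s * ((t - 1) * v - S) ^ 2 =
          (s * v + (t - 1) * S) ^ 2 := by
        rw [hN]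
        linear_combination (-(s * v ^ 2) - S ^ 2) * hst
      linarith
    exact le_of_mul_le_mul_left h8 hs
  have h10 : (t - c) / N * ((t - 1) * v - S) ^ 2 =
      ((t - 1) * ((t - 1) * v - S) ^ 2) / N - (c - 1) * (((t - 1) * v - S) ^ 2 / N) := by
    ring
  have h11 : s * v ^ 2 - 2 * v * S ≤ ((t - 1) * ((t - 1) * v - S) ^ 2) / N := by
    rw [le_div_iff₀ hNpos]; linarith
  have h12 : ((t - 1) * v - S) ^ 2 / N ≤ v ^ 2 + L := by
    rw [div_le_iff₀ hNpos]; linarith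
  have h13 := mul_le_mul_of_nonneg_left h12 (by linarith : 0 ≤ c - 1)
  rw [h10]
  linarith

/-- The form of the root and its edges, `x` the entry at the root and `b` the sum of the entries at
its `R` neighbours. -/
lemma center_form_le {R c Y x b : ℝ} (hR : 0 < R) (hY : 0 < Y)
    (h : 0 ≤ Y ^ 2 - (R - c) * Y - R) :
    R * x ^ 2 - 2 * x * b ≤ c * x ^ 2 + Y / (Y ^ 2 + R) * (Y * x - b) ^ 2 := by
  have hN : 0 < Y ^ 2 + R := by positivity
  have h1 : 0 ≤ (Y ^ 2 + R) * (Y * (Y / (Y ^ 2 + R) * (Y * x - b) ^ 2 -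
      (R * x ^ 2 - 2 * x * b - c * x ^ 2))) := by
    have h2 : (Y ^ 2 + R) * (Y * (Y / (Y ^ 2 + R) * (Y * x - b) ^ 2 -
        (R * x ^ 2 - 2 * x * b - c * x ^ 2))) =
        (Y * b + R * x) ^ 2 + (Y ^ 2 - (R - c) * Y - R) * (Y ^ 2 + R) * x ^ 2 := by
      field_simp
      ring
    rw [h2]
    positivity
  have h3 := nonneg_of_mul_nonneg_right h1 hN
  have h4 := nonneg_of_mul_nonneg_right h3 hY
  linarith

/-- The larger eigenvalue `t` of a branch with `s` leaves. -/
lemma exists_branch_root (s : ℕ) (hs : 1 ≤ s) :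
    ∃ t : ℝ, t ^ 2 = (s + 2) * t - 1 ∧ 5 / 2 ≤ t := by
  have hs' : (1 : ℝ) ≤ s := by exact_mod_cast hs
  have h0 : (0 : ℝ) ≤ ((s : ℝ) + 2) ^ 2 - 4 := by nlinarith
  have h1 := Real.sq_sqrt h0
  have h2 : 2 ≤ Real.sqrt (((s : ℝ) + 2) ^ 2 - 4) := Real.le_sqrt_of_sq_le (by nlinarith)
  exact ⟨((s : ℝ) + 2 + Real.sqrt (((s : ℝ) + 2) ^ 2 - 4)) / 2, by linarith, by linarith⟩

namespace SimpleGraph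

open DepthTwoVertex

variable {V : Type*} [Fintype V] {G : SimpleGraph V} {r : ℕ} {s : Fin r → ℕ} {p : ℕ}
  {e : DepthTwoVertex s p ≃ V}

/-- The certificate made of one rank-one form for each branch and one for the root. Here `Y` bounds
the larger eigenvalue of the matrix with rows `(R - c, √R)` and `(√R, 0)`. -/
lemma laplacianEnergy_le_of_branch_roots (hform : ∀ y, G.lapForm (y ∘ e.symm) = form y)
    (hs : ∀ i, 1 ≤ s i) (t : Fin r → ℝ) (ht : ∀ i, t i ^ 2 = (s i + 2) * t i - 1)
    (ht1 : ∀ i, 1 < t i) {c Y : ℝ} (hc : 1 ≤ c) (hct : ∀ i, c ≤ t i)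
    (hR : (0 : ℝ) < r + p) (hY : 0 < Y) (h : 0 ≤ Y ^ 2 - (r + p - c) * Y - (r + p)) :
    G.laplacianEnergy ≤
      2 * ((c - G.averageDegree) * G.numLargeEigenvalues + ((∑ i, (t i - c)) + Y)) := by
  have hs' : ∀ i, (0 : ℝ) < s i := fun i => by exact_mod_cast hs i
  have hN : ∀ i, 0 < (s i : ℝ) * (t i + 1) := fun i => mul_pos (hs' i) (by linarith [ht1 i])
  have hNY : 0 < Y ^ 2 + (r + p) := by positivity
  let w : Option (Fin r) → DepthTwoVertex s p → ℝ := fun j => match j with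
    | none => levelVec Y (fun _ => -1) (fun _ => 0) (-1)
    | some i => levelVec 0 (fun k => if k = i then t i - 1 else 0)
        (fun k => if k = i then -1 else 0) 0
  let τ : Option (Fin r) → ℝ := fun j => match j with
    | none => Y / (Y ^ 2 + (r + p))
    | some i => (t i - c) / (s i * (t i + 1))
  have key := G.laplacianEnergy_le_of_lapForm_le e c τ w ?_ ?_
  · refine key.trans_eq ?_
    rw [Fintype.sum_option]
    have h1 : ∑ m, w none m ^ 2 = Y ^ 2 + (r + p) := by
      simp only [w, sum_levelVec_sq]
      simp
    have h2 : ∀ i, ∑ m, w (some i) m ^ 2 = s i * (t i + 1) := by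
      intro i
      simp only [w, sum_levelVec_sq]
      simp only [ite_pow, mul_ite, Finset.sum_add_distrib]
      simp
      linarith [ht i]
    have h3 : τ none * ∑ m, w none m ^ 2 = Y := by
      rw [h1]; exact div_mul_cancel₀ _ hNY.ne'
    have h4 : ∀ i, τ (some i) * ∑ m, w (some i) m ^ 2 = t i - c := by
      intro i
      rw [h2]; exact div_mul_cancel₀ _ (hN i).ne'
    rw [h3, Finset.sum_congr rfl fun i _ => h4 i]
    ring
  · rintro (_ | i)
    · exact div_nonneg hY.le hNY.le
    · exact div_nonneg (by linarith [hct i]) (hN i).le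
  · intro y
    rw [hform, Fintype.sum_option, sum_eq, form]
    set x := y root
    set v := fun i => y (hub i)
    set S := fun i => ∑ j, y (leaf i j)
    set L := fun i => ∑ j, y (leaf i j) ^ 2
    set P := ∑ k, y (pendant k)
    set P2 := ∑ k, y (pendant k) ^ 2
    have e1 : ∑ m, w none m * y m = Y * x - ((∑ i, v i) + P) := by
      simp only [w, sum_levelVec_mul]
      simp only [zero_mul, add_zero, neg_mul, one_mul, Finset.sum_neg_distrib]
      ring
    have e2 : ∀ i, ∑ m, w (some i) m * y m = (t i - 1) * v i - S i := by
      intro i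
      simp only [w, sum_levelVec_mul, ite_mul, zero_mul, Finset.sum_add_distrib]
      simp
      ring
    have e3 : ∀ i, ∑ j, (v i - y (leaf i j)) ^ 2 = s i * v i ^ 2 - 2 * v i * S i + L i := by
      intro i
      simp only [sub_sq, Finset.sum_add_distrib, Finset.sum_sub_distrib, ← Finset.mul_sum]
      simp [S, L]
    have e4 : ∑ k, (x - y (pendant k)) ^ 2 = p * x ^ 2 - 2 * x * P + P2 := by
      simp only [sub_sq, Finset.sum_add_distrib, Finset.sum_sub_distrib, ← Finset.mul_sum]
      simp [P, P2]
    have hb : ∀ i, (s i + 1) * v i ^ 2 - 2 * v i * S i + L i ≤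
        c * (v i ^ 2 + L i) + (t i - c) / (s i * (t i + 1)) * ((t i - 1) * v i - S i) ^ 2 := by
      intro i
      refine branch_form_le (ht i) (ht1 i) (hs' i) hc ?_
      have := sq_sum_le_card_mul_sum_sq (s := Finset.univ) (f := fun j => y (leaf i j))
      simpa using this
    have hcen := center_form_le (x := x) (b := (∑ i, v i) + P) hR hY h
    have hP2 : P2 ≤ c * P2 :=
      le_mul_of_one_le_left (Finset.sum_nonneg fun _ _ => sq_nonneg _) hc
    have hsum := Finset.sum_le_sum fun i (_ : i ∈ Finset.univ) => hb i
    have e5 : ∑ i, ((x - v i) ^ 2 + (s i * v i ^ 2 - 2 * v i * S i + L i)) =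
        r * x ^ 2 - 2 * x * (∑ i, v i) + ∑ i, ((s i + 1) * v i ^ 2 - 2 * v i * S i + L i) := by
      have : ∀ i, (x - v i) ^ 2 + (s i * v i ^ 2 - 2 * v i * S i + L i) =
          x ^ 2 - 2 * x * v i + ((s i + 1) * v i ^ 2 - 2 * v i * S i + L i) := fun i => by ring
      rw [Finset.sum_congr rfl fun i _ => this i, Finset.sum_add_distrib, Finset.sum_sub_distrib,
        ← Finset.mul_sum]
      simp
    have e6 : ∑ i, (c * (v i ^ 2 + L i) +
        (t i - c) / (s i * (t i + 1)) * ((t i - 1) * v i - S i) ^ 2) =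
        c * ∑ i, (v i ^ 2 + L i) +
          ∑ i, (t i - c) / (s i * (t i + 1)) * ((t i - 1) * v i - S i) ^ 2 := by
      rw [Finset.sum_add_distrib, ← Finset.mul_sum]
    have e7 : ∑ i, τ (some i) * (∑ m, w (some i) m * y m) ^ 2 =
        ∑ i, (t i - c) / (s i * (t i + 1)) * ((t i - 1) * v i - S i) ^ 2 :=
      Finset.sum_congr rfl fun i _ => by rw [e2]
    have e8 : ∑ i, ((x - v i) ^ 2 + ∑ j, (v i - y (leaf i j)) ^ 2) =
        ∑ i, ((x - v i) ^ 2 + (s i * v i ^ 2 - 2 * v i * S i + L i)) :=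
      Finset.sum_congr rfl fun i _ => by rw [e3]
    have e9 : τ none = Y / (Y ^ 2 + (r + p)) := rfl
    rw [e7, e1, e9]
    change ∑ i, ((x - v i) ^ 2 + ∑ j, (v i - y (leaf i j)) ^ 2) +
      ∑ k, (x - y (pendant k)) ^ 2 ≤ c * (x ^ 2 + (∑ i, (v i ^ 2 + L i) + P2)) + _
    rw [e8, e5, e4]
    rw [e6] at hsum
    linarith

end SimpleGraph

namespace SimpleGraph

open DepthTwoVertex

variable {V : Type*} [Fintype V] {G : SimpleGraph V}

lemma card_eq_of_depthTwo_equiv {r : ℕ} {s : Fin r → ℕ} {p : ℕ} (e : DepthTwoVertex s p ≃ V) :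
    (Fintype.card V : ℝ) = 1 + ((∑ i, ((s i : ℝ) + 1)) + p) := by
  rw [← Fintype.card_congr e, DepthTwoVertex.card_eq]
  push_cast
  ring

/-- The upper bound when the root has at least three neighbours. If there are more than `r` large
eigenvalues, the certificate with `c = 1` applies, and otherwise the one with `c = 5 / 2`. The
reciprocals of the branch roots `t i` are the smaller eigenvalues of the branches, and both cases
rest on their sum being at least `2r / n`. -/
lemma laplacianEnergy_le_of_three_le {r : ℕ} {s : Fin r → ℕ} {p : ℕ} {e : DepthTwoVertex s p ≃ V}
    (hform : ∀ y, G.lapForm (y ∘ e.symm) = form y) (hs : ∀ i, 1 ≤ s i)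
    (hd : G.averageDegree = 2 - 2 / (Fintype.card V : ℝ)) (hr : 2 ≤ r) (hrp : 3 ≤ r + p) :
    G.laplacianEnergy ≤
      2 * ((Fintype.card V : ℝ) - (2 - 2 / (Fintype.card V : ℝ))) := by
  choose t ht ht2 using fun i => exists_branch_root (s i) (hs i)
  have hcard := card_eq_of_depthTwo_equiv e
  set n : ℝ := (Fintype.card V : ℝ) with hn
  set ε : ℝ := 2 / n with hε
  have hr' : (2 : ℝ) ≤ r := by exact_mod_cast hr
  have hrp' : (3 : ℝ) ≤ r + p := by exact_mod_cast hrp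
  have hp : (0 : ℝ) ≤ p := by positivity
  have hsum : 2 * (r : ℝ) ≤ ∑ i, ((s i : ℝ) + 1) := by
    have h1 : ∑ _i : Fin r, (2 : ℝ) ≤ ∑ i, ((s i : ℝ) + 1) := by
      refine Finset.sum_le_sum fun i _ => ?_
      have : (1 : ℝ) ≤ s i := by exact_mod_cast hs i
      linarith
    simpa [mul_comm] using h1
  have hn0 : 0 < n := by linarith
  have hεn : ε * n = 2 := by rw [hε]; field_simp
  have hε0 : 0 < ε := by positivity
  have hε1 : ε ≤ 1 := by rw [hε, div_le_one hn0]; linarith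
  have htinv : ∀ i, t i = s i + 2 - 1 / t i := by
    intro i
    have h1 : t i ≠ 0 := by linarith [ht2 i]
    field_simp
    linarith [ht i]
  set H := ∑ i, 1 / t i with hH
  have htsum : ∑ i, t i = (∑ i, ((s i : ℝ) + 1)) + r - H := by
    rw [Finset.sum_congr rfl fun i _ => htinv i, Finset.sum_sub_distrib, hH,
      Finset.sum_congr rfl (g := fun i => ((s i : ℝ) + 1) + 1) fun i _ => by ring,
      Finset.sum_add_distrib (g := fun _ => (1 : ℝ))]
    simp
  have hHlow : r * ε ≤ H := by
    have h1 : ∀ i, 2 * ε - ε ^ 2 * ((s i : ℝ) + 1 + 1) ≤ 1 / t i := by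
      intro i
      have h0 : 0 < t i := by linarith [ht2 i]
      have h2 : t i ≤ (s i : ℝ) + 1 + 1 := by
        have : 0 < 1 / t i := by positivity
        linarith [htinv i]
      -- The tangent of `1 / t` at `t = 1 / ε = n / 2`.
      have h3 : 2 * ε - ε ^ 2 * t i ≤ 1 / t i := by
        rw [le_div_iff₀ h0]
        nlinarith [sq_nonneg (ε * t i - 1)]
      have h4 : ε ^ 2 * t i ≤ ε ^ 2 * ((s i : ℝ) + 1 + 1) :=
        mul_le_mul_of_nonneg_left h2 (sq_nonneg _)
      linarith
    have h2 := Finset.sum_le_sum fun i (_ : i ∈ Finset.univ) => h1 i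
    rw [Finset.sum_sub_distrib, ← Finset.mul_sum _ _ (ε ^ 2),
      Finset.sum_add_distrib (g := fun _ => (1 : ℝ))] at h2
    simp only [Finset.sum_const, Finset.card_univ, Fintype.card_fin, nsmul_eq_mul, mul_one] at h2
    -- This is where three neighbours of the root are needed: it fails for `r = 2` and `p = 0`.
    have h3 : 2 * (n - 1 - p + r) ≤ r * n := by
      have h5 : 1 + 2 * (r : ℝ) + p ≤ n := by linarith
      rcases Nat.lt_or_ge 2 r with h4 | h4
      · have h6 : (3 : ℝ) ≤ r := by exact_mod_cast h4
        nlinarith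
      · have h6 : r = 2 := le_antisymm h4 hr
        have h7 : (r : ℝ) = 2 := by rw [h6]; norm_num
        rw [h7] at hrp' ⊢
        linarith
    have h4 : ε ^ 2 * (n - 1 - p + r) ≤ ε * r := by
      have h5 : ε ^ 2 * (2 * (n - 1 - p + r)) ≤ ε ^ 2 * (r * n) :=
        mul_le_mul_of_nonneg_left h3 (sq_nonneg _)
      have h6 : ε ^ 2 * (r * n) = 2 * (ε * r) := by linear_combination (ε * r) * hεn
      linarith
    have h5 : (∑ i, ((s i : ℝ) + 1)) + r = n - 1 - p + r := by linarith
    rw [h5] at h2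
    linarith
  have htc : ∀ c, ∑ i, (t i - c) = (∑ i, t i) - r * c := by
    intro c
    rw [Finset.sum_sub_distrib]
    simp
  rcases Nat.lt_or_ge r G.numLargeEigenvalues with hk | hk
  · have hk' : (r : ℝ) + 1 ≤ G.numLargeEigenvalues := by exact_mod_cast hk
    refine (laplacianEnergy_le_of_branch_roots hform hs t ht (fun i => by linarith [ht2 i])
      (c := 1) (Y := r + p) le_rfl (fun i => by linarith [ht2 i]) (by linarith) (by linarith)
      (by nlinarith)).trans ?_
    rw [htc, htsum, hd]
    have h1 := mul_le_mul_of_nonneg_left hk' (by linarith : 0 ≤ 1 - ε)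
    linarith
  · have hk' : (G.numLargeEigenvalues : ℝ) ≤ r := by exact_mod_cast hk
    refine (laplacianEnergy_le_of_branch_roots hform hs t ht (fun i => by linarith [ht2 i])
      (c := 5 / 2) (Y := r + p - 1) (by norm_num) ht2 (by linarith) (by linarith)
      (by nlinarith)).trans ?_
    rw [htc, htsum, hd]
    have h1 := mul_le_mul_of_nonneg_left hk' (by linarith : 0 ≤ 1 / 2 + ε)
    linarith

/-- With two branches and no leaves at the root, the Laplacian is the sum of the Laplacians of the
stars formed by the root and either branch, each at most the identity on its vertices plus a
rank-one form. -/
lemma laplacianEnergy_le_of_two_stars {s : Fin 2 → ℕ} {e : DepthTwoVertex s 0 ≃ V}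
    (hform : ∀ y, G.lapForm (y ∘ e.symm) = form y) :
    G.laplacianEnergy ≤
      2 * ((1 - G.averageDegree) * G.numLargeEigenvalues + Fintype.card V) := by
  have hcard := card_eq_of_depthTwo_equiv e
  let w : Option (Fin 2) → DepthTwoVertex s 0 → ℝ := fun j => match j with
    | none => levelVec 1 (fun _ => 0) (fun _ => 0) 0
    | some i => levelVec (-1) (fun k => if k = i then (s i : ℝ) + 1 else 0)
        (fun k => if k = i then -1 else 0) 0
  let τ : Option (Fin 2) → ℝ := fun j => match j with
    | none => 1
    | some i => 1 / ((s i : ℝ) + 2)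
  have key := G.laplacianEnergy_le_of_lapForm_le e 1 τ w ?_ ?_
  · refine key.trans_eq ?_
    have h1 : ∑ m, w none m ^ 2 = 1 := by
      simp only [w, sum_levelVec_sq]
      simp
    have h2 : ∀ i, ∑ m, w (some i) m ^ 2 = ((s i : ℝ) + 1) * (s i + 2) := by
      intro i
      simp only [w, sum_levelVec_sq, ite_pow, mul_ite, Finset.sum_add_distrib]
      simp
      ring
    have h3 : ∀ i, τ (some i) * ∑ m, w (some i) m ^ 2 = s i + 1 := by
      intro i
      rw [h2]
      have : (s i : ℝ) + 2 ≠ 0 := by positivity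
      simp only [τ]
      field_simp
    rw [Fintype.sum_option, h1, Finset.sum_congr rfl fun i _ => h3 i, hcard]
    simp [τ]
  · rintro (_ | i)
    · exact zero_le_one
    · simp only [τ]; positivity
  · intro y
    rw [hform, Fintype.sum_option, sum_eq, form]
    set x := y root
    set v := fun i => y (hub i)
    set S := fun i => ∑ j, y (leaf i j)
    set L := fun i => ∑ j, y (leaf i j) ^ 2
    have e1 : ∑ m, w none m * y m = x := by
      simp only [w, sum_levelVec_mul]
      simp [x]
    have e2 : ∀ i, ∑ m, w (some i) m * y m = (s i + 1) * v i - S i - x := by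
      intro i
      simp only [w, sum_levelVec_mul, ite_mul, zero_mul, Finset.sum_add_distrib]
      simp
      ring
    have e3 : ∀ i, ∑ j, (v i - y (leaf i j)) ^ 2 = s i * v i ^ 2 - 2 * v i * S i + L i := by
      intro i
      simp only [sub_sq, Finset.sum_add_distrib, Finset.sum_sub_distrib, ← Finset.mul_sum]
      simp [S, L]
    have hb : ∀ i, (x - v i) ^ 2 + (s i * v i ^ 2 - 2 * v i * S i + L i) ≤
        v i ^ 2 + L i + x ^ 2 + 1 / ((s i : ℝ) + 2) * ((s i + 1) * v i - S i - x) ^ 2 := by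
      intro i
      have h0 : (0 : ℝ) < s i + 2 := by positivity
      have h1 : v i ^ 2 + L i + x ^ 2 + 1 / ((s i : ℝ) + 2) * ((s i + 1) * v i - S i - x) ^ 2 -
          ((x - v i) ^ 2 + (s i * v i ^ 2 - 2 * v i * S i + L i)) =
          (v i + (S i + x)) ^ 2 / (s i + 2) := by
        field_simp
        ring
      have h2 : 0 ≤ (v i + (S i + x)) ^ 2 / ((s i : ℝ) + 2) := by positivity
      linarith
    have e4 : τ none = 1 := rfl
    rw [e1, e4, Finset.sum_congr rfl fun i _ => congrArg (fun z => τ (some i) * z ^ 2) (e2 i)]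
    change ∑ i, ((x - v i) ^ 2 + ∑ j, (v i - y (leaf i j)) ^ 2) +
      ∑ k, (x - y (pendant k)) ^ 2 ≤
        1 * (x ^ 2 + (∑ i, (v i ^ 2 + L i) + ∑ k, y (pendant k) ^ 2)) +
        (1 * x ^ 2 + ∑ i, 1 / ((s i : ℝ) + 2) * ((s i + 1) * v i - S i - x) ^ 2)
    rw [Finset.sum_congr rfl fun i _ => congrArg (fun z => (x - v i) ^ 2 + z) (e3 i)]
    simp only [Fin.sum_univ_two, Finset.univ_eq_empty, Finset.sum_empty, add_zero]
    linarith [hb 0, hb 1]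

/-- The upper bound for two branches and no leaves at the root. Three or more large eigenvalues are
covered by `laplacianEnergy_le_of_two_stars`; for at most two, the constant `c` of the certificate is
adapted to the smaller branch. -/
lemma laplacianEnergy_le_of_two_branches {s : Fin 2 → ℕ} {e : DepthTwoVertex s 0 ≃ V}
    (hform : ∀ y, G.lapForm (y ∘ e.symm) = form y) (hs : ∀ i, 1 ≤ s i) (hmono : Monotone s)
    (hd : G.averageDegree = 2 - 2 / (Fintype.card V : ℝ)) :
    G.laplacianEnergy ≤
      2 * ((Fintype.card V : ℝ) - (2 - 2 / (Fintype.card V : ℝ))) := by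
  have hcard := card_eq_of_depthTwo_equiv e
  have hstars := laplacianEnergy_le_of_two_stars hform
  set n : ℝ := (Fintype.card V : ℝ) with hn
  set ε : ℝ := 2 / n with hε
  rw [Fin.sum_univ_two] at hcard
  push_cast at hcard
  have hs0 : (1 : ℝ) ≤ s 0 := by exact_mod_cast hs 0
  have hs1 : (1 : ℝ) ≤ s 1 := by exact_mod_cast hs 1
  have hn0 : 5 ≤ n := by linarith
  have hεn : ε * n = 2 := by rw [hε]; field_simp
  have hε0 : 0 < ε := by positivity
  have hε1 : ε ≤ 1 / 2 := by rw [hε, div_le_div_iff₀ (by linarith) (by norm_num)]; linarith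
  rcases Nat.lt_or_ge 2 G.numLargeEigenvalues with hk | hk
  · have hk' : (3 : ℝ) ≤ G.numLargeEigenvalues := by exact_mod_cast hk
    refine hstars.trans ?_
    rw [hd]
    have h1 := mul_le_mul_of_nonneg_left hk' (by linarith : 0 ≤ 1 - ε)
    linarith
  have hk' : (G.numLargeEigenvalues : ℝ) ≤ 2 := by exact_mod_cast hk
  choose t ht ht2 using fun i => exists_branch_root (s i) (hs i)
  have htinv : ∀ i, t i = s i + 2 - 1 / t i := by
    intro i
    have h1 : t i ≠ 0 := by linarith [ht2 i]
    field_simp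
    linarith [ht i]
  have hinv : ∀ i, 1 / ((s i : ℝ) + 2) ≤ 1 / t i := by
    intro i
    have h0 : 0 < t i := by linarith [ht2 i]
    have h1 : 0 < 1 / t i := by positivity
    exact one_div_le_one_div_of_le h0 (by linarith [htinv i])
  rcases Nat.lt_or_ge 1 (s 0) with h0 | h0
  · -- Both branches have at least two leaves, so their roots are at least `3`.
    have hge2 : ∀ i, (2 : ℝ) ≤ s i := by
      intro i
      have : s 0 ≤ s i := hmono (Fin.zero_le i)
      exact_mod_cast (by omega : 2 ≤ s i)
    have ht3 : ∀ i, 3 ≤ t i := by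
      intro i
      by_contra h
      push Not at h
      nlinarith [ht i, ht2 i, hge2 i]
    refine (laplacianEnergy_le_of_branch_roots hform hs t ht (fun i => by linarith [ht2 i])
      (c := 3) (Y := 1) (by norm_num) ht3 (by norm_num) (by norm_num) (by norm_num)).trans ?_
    rw [hd, Fin.sum_univ_two]
    have h1 := mul_le_mul_of_nonneg_left hk' (by linarith : 0 ≤ 1 + ε)
    have h2 : ∀ i, 1 / n ≤ 1 / t i := by
      intro i
      refine (one_div_le_one_div_of_le (by positivity) ?_).trans (hinv i)
      fin_cases i
      · simp only [Fin.zero_eta]; linarith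
      · simp only [Fin.mk_one]; linarith
    have h3 : ε = 1 / n + 1 / n := by rw [hε]; ring
    linarith [htinv 0, htinv 1, h2 0, h2 1]
  · -- One branch is a single edge; its root is the square of the golden ratio.
    have hs01 : s 0 = 1 := le_antisymm h0 (hs 0)
    have hs01' : (s 0 : ℝ) = 1 := by rw [hs01]; norm_num
    refine (laplacianEnergy_le_of_branch_roots hform hs t ht (fun i => by linarith [ht2 i])
      (c := 5 / 2) (Y := 6 / 5) (by norm_num) ht2 (by norm_num) (by norm_num)
      (by norm_num)).trans ?_
    rw [hd, Fin.sum_univ_two]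
    have h1 := mul_le_mul_of_nonneg_left hk' (by linarith : 0 ≤ 1 / 2 + ε)
    have h2 : t 0 ≤ 2.62 := by
      have h3 := ht 0
      rw [hs01'] at h3
      by_contra h
      push Not at h
      nlinarith
    have h3 : 0.38 ≤ 1 / t 0 := by
      have := htinv 0
      rw [hs01'] at this
      linarith
    have h4 : ε - 0.18 ≤ 1 / t 1 := by
      refine le_trans ?_ (hinv 1)
      have h5 : (s 1 : ℝ) + 2 = n - 2 := by linarith
      rw [h5, hε, le_div_iff₀ (by linarith)]
      have h6 : (2 / n - 0.18) * (n - 2) = 2 - 4 / n - 0.18 * (n - 2) := by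
        field_simp
        ring
      rw [h6]
      have h8 : 1 - 0.18 * (n - 2) ≤ 4 / n := by
        rw [le_div_iff₀ (by linarith)]
        nlinarith [sq_nonneg (n - 34 / 9)]
      linarith
    linarith [htinv 0, htinv 1]

/-- The upper bound for the energy of a tree of diameter four. -/
theorem IsTree.laplacianEnergy_le_of_diam_eq_four (hT : G.IsTree) (hd : G.diam = 4) :
    G.laplacianEnergy ≤
      2 * ((Fintype.card V : ℝ) - (2 - 2 / (Fintype.card V : ℝ))) := by
  obtain ⟨r, s, p, e, hr, hmono, hs, hform⟩ := hT.exists_depthTwo_equiv hd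
  rcases Nat.lt_or_ge (r + p) 3 with h | h
  · obtain rfl : r = 2 := by omega
    obtain rfl : p = 0 := by omega
    exact laplacianEnergy_le_of_two_branches hform hs hmono hT.averageDegree_eq
  · exact laplacianEnergy_le_of_three_le hform hs hT.averageDegree_eq hr h

end SimpleGraph

/-! ### The lower bound -/

namespace SimpleGraph

open DepthTwoVertex

variable {V : Type*} [Fintype V] {G : SimpleGraph V} {r : ℕ} {s : Fin r → ℕ} {p : ℕ}
  {e : DepthTwoVertex s p ≃ V}

lemma le_laplacianEnergy_of_levelVec (hform : ∀ y, G.lapForm (y ∘ e.symm) = form y)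
    {J : Type*} [Fintype J] (α : J → ℝ) (β γ : J → Fin r → ℝ) (δ : J → ℝ)
    (horth : Pairwise fun i j =>
      α i * α j + ((∑ k, (β i k * β j k + s k * (γ i k * γ j k))) + p * (δ i * δ j)) = 0)
    (hpos : ∀ j, 0 < α j ^ 2 + ((∑ k, (β j k ^ 2 + s k * γ j k ^ 2)) + p * δ j ^ 2)) :
    2 * ∑ j, (((∑ k, ((α j - β j k) ^ 2 + s k * (β j k - γ j k) ^ 2)) + p * (α j - δ j) ^ 2) /
      (α j ^ 2 + ((∑ k, (β j k ^ 2 + s k * γ j k ^ 2)) + p * δ j ^ 2)) - G.averageDegree) ≤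
      G.laplacianEnergy := by
  have h := G.le_laplacianEnergy_of_orthogonal e (fun j => levelVec (α j) (β j) (γ j) (δ j))
    (fun i j hij => by simpa only [sum_levelVec_mul_levelVec] using horth hij)
    (fun j => by simpa only [sum_levelVec_sq] using hpos j)
  simpa only [hform, form_levelVec, sum_levelVec_sq] using h

/-- The lower bound obtained from disjointly supported vectors: `s i + 1` at the hub and `-1` at the
leaves of a branch, and `R = r + p` at the root and `-1` at its leaves. -/
lemma le_laplacianEnergy_of_depthTwo (hform : ∀ y, G.lapForm (y ∘ e.symm) = form y)
    (hd : G.averageDegree = 2 - 2 / (Fintype.card V : ℝ)) (hr : 1 ≤ r) :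
    2 * ((Fintype.card V : ℝ) - 3 - (∑ i, ((s i : ℝ) + 1) / ((s i : ℝ) ^ 2 + 3 * s i + 1)) +
      (r + 1) * (2 / (Fintype.card V : ℝ)) +
      p * ((r : ℝ) + p + 1) / (((r : ℝ) + p) ^ 2 + p)) ≤ G.laplacianEnergy := by
  have hcard := card_eq_of_depthTwo_equiv e
  set n : ℝ := (Fintype.card V : ℝ) with hn
  have hr' : (1 : ℝ) ≤ r := by exact_mod_cast hr
  have hR : (0 : ℝ) < ((r : ℝ) + p) ^ 2 + p := by positivity
  have key := le_laplacianEnergy_of_levelVec (J := Option (Fin r)) hform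
    (fun j => j.elim ((r : ℝ) + p) fun _ => 0)
    (fun j => j.elim (fun _ => 0) fun i k => if k = i then (s i : ℝ) + 1 else 0)
    (fun j => j.elim (fun _ => 0) fun i k => if k = i then -1 else 0)
    (fun j => j.elim (-1) fun _ => 0) ?_ ?_
  · refine le_trans (le_of_eq ?_) key
    rw [Fintype.sum_option, hd]
    simp only [Option.elim_none, Option.elim_some]
    have h1 : ∀ i : Fin r, ((∑ k, ((0 - if k = i then (s i : ℝ) + 1 else 0) ^ 2 +
        s k * ((if k = i then (s i : ℝ) + 1 else 0) - if k = i then -1 else 0) ^ 2)) +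
        p * (0 - 0) ^ 2) = ((s i : ℝ) + 1) ^ 2 + s i * (s i + 2) ^ 2 := by
      intro i
      rw [Finset.sum_eq_single i]
      · simp; ring
      · intro k _ hk
        simp [hk]
      · simp
    have h2 : ∀ i : Fin r, (0 : ℝ) ^ 2 + ((∑ k, ((if k = i then (s i : ℝ) + 1 else 0) ^ 2 +
        s k * (if k = i then -1 else 0) ^ 2)) + p * 0 ^ 2) = (s i : ℝ) ^ 2 + 3 * s i + 1 := by
      intro i
      rw [Finset.sum_eq_single i]
      · simp; ring
      · intro k _ hk
        simp [hk]
      · simp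
    have h3 : ∀ i : Fin r, (((s i : ℝ) + 1) ^ 2 + s i * (s i + 2) ^ 2) /
        ((s i : ℝ) ^ 2 + 3 * s i + 1) - (2 - 2 / n) =
        ((s i : ℝ) + 1) - ((s i : ℝ) + 1) / ((s i : ℝ) ^ 2 + 3 * s i + 1) - (1 - 2 / n) := by
      intro i
      have : (0 : ℝ) < (s i : ℝ) ^ 2 + 3 * s i + 1 := by positivity
      have h4 : (((s i : ℝ) + 1) ^ 2 + s i * (s i + 2) ^ 2) / ((s i : ℝ) ^ 2 + 3 * s i + 1) =
          (s i + 2) - ((s i : ℝ) + 1) / ((s i : ℝ) ^ 2 + 3 * s i + 1) := by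
        field_simp
        ring
      rw [h4]
      ring
    have h4 : ((∑ k : Fin r, (((r : ℝ) + p - 0) ^ 2 + (s k : ℝ) * (0 - 0) ^ 2)) +
        p * ((r : ℝ) + p - -1) ^ 2) /
        (((r : ℝ) + p) ^ 2 + ((∑ k : Fin r, ((0 : ℝ) ^ 2 + (s k : ℝ) * 0 ^ 2)) + p * (-1) ^ 2)) =
        r + p + p * ((r : ℝ) + p + 1) / (((r : ℝ) + p) ^ 2 + p) := by
      simp
      field_simp
      ring
    rw [h4]
    simp only [h1, h2, h3, Finset.sum_sub_distrib, Finset.sum_const, Finset.card_univ,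
      Fintype.card_fin, nsmul_eq_mul]
    linear_combination 2 * hcard
  · rintro (_ | i) (_ | j) hij
    · exact absurd rfl hij
    · simp
    · simp
    · have hij' : i ≠ j := fun h => hij (by rw [h])
      simp only [Option.elim_some]
      rw [Finset.sum_eq_zero]
      · simp
      · intro k _
        by_cases hk : k = i
        · subst hk
          simp [hij']
        · simp [hk]
  · rintro (_ | i)
    · simp only [Option.elim_none]
      have : (0 : ℝ) < ((r : ℝ) + p) ^ 2 := by positivity
      simp
      positivity
    · simp only [Option.elim_some]
      rw [Finset.sum_eq_single i]
      · simp; positivity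
      · intro k _ hk
        simp [hk]
      · simp

/-- The bound for the energy of the path, in decimals: `2 / π < 0.63664`. -/
lemma four_mul_div_pi_le (n : ℕ) : 4 * n / Real.pi ≤ 2 * (0.63664 * (n : ℝ)) := by
  rw [div_le_iff₀ Real.pi_pos]
  have := Real.pi_gt_d4
  nlinarith [(Nat.cast_nonneg n : (0 : ℝ) ≤ n)]

/-- The lower bound for at least ten vertices, where it suffices that a branch contributes at most
`0.4`, its value for a single leaf, to the sum in `le_laplacianEnergy_of_depthTwo`. -/
lemma le_laplacianEnergy_of_ten_le (hform : ∀ y, G.lapForm (y ∘ e.symm) = form y)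
    (hd : G.averageDegree = 2 - 2 / (Fintype.card V : ℝ)) (hr : 2 ≤ r) (hs : ∀ i, 1 ≤ s i)
    (hn : 10 ≤ Fintype.card V) :
    2 * (0.63664 * (Fintype.card V : ℝ)) ≤ G.laplacianEnergy := by
  have key := le_laplacianEnergy_of_depthTwo hform hd (by omega)
  have hcard := card_eq_of_depthTwo_equiv e
  have hn' : (10 : ℝ) ≤ (Fintype.card V : ℝ) := by exact_mod_cast hn
  have h1 : ∑ i, ((s i : ℝ) + 1) / ((s i : ℝ) ^ 2 + 3 * s i + 1) ≤ (0.4 * r : ℝ) := by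
    have h2 : ∑ i, ((s i : ℝ) + 1) / ((s i : ℝ) ^ 2 + 3 * s i + 1) ≤ ∑ _i : Fin r, (0.4 : ℝ) := by
      refine Finset.sum_le_sum fun i _ => ?_
      have h3 : (1 : ℝ) ≤ s i := by exact_mod_cast hs i
      rw [div_le_iff₀ (by positivity)]
      nlinarith
    simpa [mul_comm] using h2
  have h2 : (0 : ℝ) ≤ p * ((r : ℝ) + p + 1) / (((r : ℝ) + p) ^ 2 + p) := by positivity
  have h3 : 2 * (r : ℝ) + 1 ≤ (Fintype.card V : ℝ) := by
    have h4 : ∑ _i : Fin r, (2 : ℝ) ≤ ∑ i, ((s i : ℝ) + 1) := by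
      refine Finset.sum_le_sum fun i _ => ?_
      have : (1 : ℝ) ≤ s i := by exact_mod_cast hs i
      linarith
    have h5 : (0 : ℝ) ≤ p := by positivity
    simp only [Finset.sum_const, Finset.card_univ, Fintype.card_fin, nsmul_eq_mul] at h4
    linarith
  have h4 : 0 ≤ 0.36336 * (Fintype.card V : ℝ) - 3 - 0.4 * r +
      (r + 1) * (2 / (Fintype.card V : ℝ)) := by
    set n : ℝ := (Fintype.card V : ℝ) with hnn
    have h5 : 0.36336 * n - 3 - 0.4 * r + (r + 1) * (2 / n) =
        (0.36336 * n ^ 2 - 3 * n - 0.4 * r * n + 2 * (r + 1)) / n := by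
      field_simp
    rw [h5]
    refine div_nonneg ?_ (by linarith)
    rcases Nat.lt_or_ge 10 (Fintype.card V) with h6 | h6
    · have h7 : (11 : ℝ) ≤ n := by rw [hnn]; exact_mod_cast h6
      nlinarith
    · have h7 : n = 10 := by rw [hnn]; exact_mod_cast le_antisymm h6 hn
      have h8 : (r : ℝ) ≤ 4 := by
        rw [h7] at h3
        have h9 : 2 * r + 1 ≤ 10 := by exact_mod_cast h3
        exact_mod_cast (by omega : r ≤ 4)
      rw [h7]
      linarith
  refine le_trans ?_ key
  linarith

end SimpleGraph

/-! ### Small trees -/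

/-- The numerical estimate behind the lower bound, for two branches and at most nine vertices, with
four exceptions. -/
lemma two_branch_estimate {a b p : ℕ} (ha : 1 ≤ a) (hab : a ≤ b) (h6 : 3 ≤ a + b + p)
    (h9 : a + b + p ≤ 6) (hA : ¬ (a = 1 ∧ b = 1 ∧ p = 1)) (hB : ¬ (a = 1 ∧ b = 2 ∧ p = 0))
    (hC : ¬ (a = 2 ∧ b = 2 ∧ p = 0)) (hD : ¬ (a = 1 ∧ b = 3 ∧ p = 0)) :
    0.63664 * (a + b + p + 3 : ℝ) ≤ (a + b + p + 3 : ℝ) - 3 -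
      (((a : ℝ) + 1) / ((a : ℝ) ^ 2 + 3 * a + 1) + ((b : ℝ) + 1) / ((b : ℝ) ^ 2 + 3 * b + 1)) +
      (2 + 1) * (2 / (a + b + p + 3 : ℝ)) + p * ((2 : ℝ) + p + 1) / (((2 : ℝ) + p) ^ 2 + p) := by
  have ha3 : a ≤ 3 := by omega
  interval_cases a <;>
  · have hb5 : b ≤ 5 := by omega
    interval_cases b <;> first
    | omega
    | (have hp4 : p ≤ 4 := by omega
       interval_cases p <;> first
       | omega
       | norm_num)

/-- The numerical estimate behind the lower bound, for three branches and at most nine vertices, with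
two exceptions. -/
lemma three_branch_estimate {a b c p : ℕ} (ha : 1 ≤ a) (hab : a ≤ b) (hbc : b ≤ c)
    (h9 : a + b + c + p ≤ 5) (hA : ¬ (c = 1 ∧ p = 0)) (hB : ¬ (b = 1 ∧ c = 2 ∧ p = 0)) :
    0.63664 * (a + b + c + p + 4 : ℝ) ≤ (a + b + c + p + 4 : ℝ) - 3 -
      (((a : ℝ) + 1) / ((a : ℝ) ^ 2 + 3 * a + 1) + ((b : ℝ) + 1) / ((b : ℝ) ^ 2 + 3 * b + 1) +
        ((c : ℝ) + 1) / ((c : ℝ) ^ 2 + 3 * c + 1)) +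
      (3 + 1) * (2 / (a + b + c + p + 4 : ℝ)) +
      p * ((3 : ℝ) + p + 1) / (((3 : ℝ) + p) ^ 2 + p) := by
  obtain rfl : a = 1 := by omega
  have hb2 : b ≤ 2 := by omega
  interval_cases b <;>
  · have hc3 : c ≤ 3 := by omega
    interval_cases c <;> first
    | omega
    | (have hp4 : p ≤ 2 := by omega
       interval_cases p <;> first
       | omega
       | norm_num)

namespace SimpleGraph

open DepthTwoVertex

variable {V : Type*} [Fintype V] {G : SimpleGraph V}

/-- The lower bound for two branches and six to nine vertices. In the four exceptions to
`two_branch_estimate` the test vectors are integral, exactly orthogonal approximations of the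
eigenvectors for the two or three largest eigenvalues. -/
lemma le_laplacianEnergy_of_two_branches {s : Fin 2 → ℕ} {p : ℕ} {e : DepthTwoVertex s p ≃ V}
    (hform : ∀ y, G.lapForm (y ∘ e.symm) = form y)
    (hd : G.averageDegree = 2 - 2 / (Fintype.card V : ℝ)) (hs : ∀ i, 1 ≤ s i) (hmono : Monotone s)
    (h6 : 6 ≤ Fintype.card V) (h9 : Fintype.card V ≤ 9) :
    2 * (0.63664 * (Fintype.card V : ℝ)) ≤ G.laplacianEnergy := by
  have hcard : Fintype.card V = s 0 + s 1 + p + 3 := by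
    rw [← Fintype.card_congr e, DepthTwoVertex.card_eq, Fin.sum_univ_two]
    omega
  have h01 : s 0 ≤ s 1 := hmono (Fin.zero_le 1)
  by_cases hA : s 0 = 1 ∧ s 1 = 1 ∧ p = 1
  · obtain ⟨ha, hb, rfl⟩ := hA
    rw [ha, hb] at hcard
    rw [hcard] at hd ⊢
    have key := le_laplacianEnergy_of_levelVec (J := Fin 3) hform ![6, 0, 1]
      ![![-3, -3], ![-2, 2], ![1, 1]]
      ![![1, 1], ![1, -1], ![-1, -1]] ![-2, 0, -1] ?_ ?_
    · simp [Fin.sum_univ_three, Fin.sum_univ_two, ha, hb, hd] at key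
      norm_num at key ⊢
      linarith
    · intro i j hij
      fin_cases i <;> fin_cases j <;> simp [Fin.sum_univ_two, ha, hb] at hij ⊢ <;> norm_num
    · intro j
      fin_cases j <;> simp [Fin.sum_univ_two, ha, hb] <;> norm_num
  by_cases hB : s 0 = 1 ∧ s 1 = 2 ∧ p = 0
  · obtain ⟨ha, hb, rfl⟩ := hB
    rw [ha, hb] at hcard
    rw [hcard] at hd ⊢
    have key := le_laplacianEnergy_of_levelVec (J := Fin 2) hform ![-2, 2]
      ![![1, 3], ![-4, 2]]
      ![![0, -1], ![2, -1]] ![0, 0] ?_ ?_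
    · simp [Fin.sum_univ_two, ha, hb, hd] at key
      norm_num at key ⊢
      linarith
    · intro i j hij
      fin_cases i <;> fin_cases j <;> simp [Fin.sum_univ_two, ha, hb] at hij ⊢ <;> norm_num
    · intro j
      fin_cases j <;> simp [Fin.sum_univ_two, ha, hb] <;> norm_num
  by_cases hC : s 0 = 2 ∧ s 1 = 2 ∧ p = 0
  · obtain ⟨ha, hb, rfl⟩ := hC
    rw [ha, hb] at hcard
    rw [hcard] at hd ⊢
    have key := le_laplacianEnergy_of_levelVec (J := Fin 2) hform ![-2, 0]
      ![![2, 2], ![-2, 2]]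
      ![![-1, -1], ![1, -1]] ![0, 0] ?_ ?_
    · simp [Fin.sum_univ_two, ha, hb, hd] at key
      norm_num at key ⊢
      linarith
    · intro i j hij
      fin_cases i <;> fin_cases j <;> simp [Fin.sum_univ_two, ha, hb] at hij ⊢ <;> norm_num
    · intro j
      fin_cases j <;> simp [Fin.sum_univ_two, ha, hb] <;> norm_num
  by_cases hD : s 0 = 1 ∧ s 1 = 3 ∧ p = 0
  · obtain ⟨ha, hb, rfl⟩ := hD
    rw [ha, hb] at hcard
    rw [hcard] at hd ⊢
    have key := le_laplacianEnergy_of_levelVec (J := Fin 2) hform ![-1, 3]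
      ![![1, 4], ![-4, 1]]
      ![![0, -1], ![2, -1]] ![0, 0] ?_ ?_
    · simp [Fin.sum_univ_two, ha, hb, hd] at key
      norm_num at key ⊢
      linarith
    · intro i j hij
      fin_cases i <;> fin_cases j <;> simp [Fin.sum_univ_two, ha, hb] at hij ⊢
    · intro j
      fin_cases j <;> simp [Fin.sum_univ_two, ha, hb] <;> norm_num
  have key := le_laplacianEnergy_of_depthTwo hform hd (by norm_num)
  have hnum := two_branch_estimate (hs 0) h01 (by omega) (by omega) hA hB hC hD
  rw [hcard] at key ⊢
  rw [Fin.sum_univ_two] at key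
  push_cast at key ⊢
  refine le_trans ?_ key
  exact mul_le_mul_of_nonneg_left hnum (by norm_num)

/-- The lower bound for three branches and at most nine vertices. In the two exceptions to
`three_branch_estimate` the test vectors are integral, exactly orthogonal approximations of the
eigenvectors for the three largest eigenvalues. -/
lemma le_laplacianEnergy_of_three_branches {s : Fin 3 → ℕ} {p : ℕ} {e : DepthTwoVertex s p ≃ V}
    (hform : ∀ y, G.lapForm (y ∘ e.symm) = form y)
    (hd : G.averageDegree = 2 - 2 / (Fintype.card V : ℝ)) (hs : ∀ i, 1 ≤ s i) (hmono : Monotone s)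
    (h9 : Fintype.card V ≤ 9) :
    2 * (0.63664 * (Fintype.card V : ℝ)) ≤ G.laplacianEnergy := by
  have hcard : Fintype.card V = s 0 + s 1 + s 2 + p + 4 := by
    rw [← Fintype.card_congr e, DepthTwoVertex.card_eq, Fin.sum_univ_three]
    omega
  have h01 : s 0 ≤ s 1 := hmono (Fin.zero_le 1)
  have h12 : s 1 ≤ s 2 := hmono (by decide)
  have h0 : 1 ≤ s 0 := hs 0
  by_cases hA : s 2 = 1 ∧ p = 0
  · obtain ⟨hc, rfl⟩ := hA
    have hb : s 1 = 1 := by omega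
    have ha : s 0 = 1 := by omega
    rw [ha, hb, hc] at hcard
    rw [hcard] at hd ⊢
    have key := le_laplacianEnergy_of_levelVec (J := Fin 3) hform ![7, 0, 0]
      ![![-3, -3, -3], ![3, -3, 0], ![3, 3, -6]]
      ![![1, 1, 1], ![-2, 2, 0], ![-2, -2, 4]] ![0, 0, 0] ?_ ?_
    · simp [Fin.sum_univ_three, ha, hb, hc, hd] at key
      norm_num at key ⊢
      linarith
    · intro i j hij
      fin_cases i <;> fin_cases j <;> simp [Fin.sum_univ_three, ha, hb, hc] at hij ⊢ <;> norm_num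
    · intro j
      fin_cases j <;> simp [Fin.sum_univ_three, ha, hb, hc] <;> norm_num
  by_cases hB : s 1 = 1 ∧ s 2 = 2 ∧ p = 0
  · obtain ⟨hb, hc, rfl⟩ := hB
    have ha : s 0 = 1 := by omega
    rw [ha, hb, hc] at hcard
    rw [hcard] at hd ⊢
    have key := le_laplacianEnergy_of_levelVec (J := Fin 3) hform ![4, 1, 0]
      ![![-2, -2, -3], ![-1, -1, 2], ![-2, 2, 0]]
      ![![0, 0, 1], ![1, 1, -1], ![1, -1, 0]] ![0, 0, 0] ?_ ?_
    · simp [Fin.sum_univ_three, ha, hb, hc, hd] at key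
      norm_num at key ⊢
      linarith
    · intro i j hij
      fin_cases i <;> fin_cases j <;> simp [Fin.sum_univ_three, ha, hb, hc] at hij ⊢ <;> norm_num
    · intro j
      fin_cases j <;> simp [Fin.sum_univ_three, ha, hb, hc] <;> norm_num
  have key := le_laplacianEnergy_of_depthTwo hform hd (by norm_num)
  have hnum := three_branch_estimate h0 h01 h12 (by omega) hA hB
  rw [hcard] at key ⊢
  rw [Fin.sum_univ_three] at key
  push_cast at key ⊢
  refine le_trans ?_ key
  exact mul_le_mul_of_nonneg_left hnum (by norm_num)

/-- The lower bound for four branches and at most nine vertices, which leaves only the tree with one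
leaf in each branch and no leaf at the root. The test vectors approximate its four large
eigenvectors: a symmetric one, and three contrasts between branches. -/
lemma le_laplacianEnergy_of_four_branches {s : Fin 4 → ℕ} {p : ℕ} {e : DepthTwoVertex s p ≃ V}
    (hform : ∀ y, G.lapForm (y ∘ e.symm) = form y)
    (hd : G.averageDegree = 2 - 2 / (Fintype.card V : ℝ)) (hs : ∀ i, 1 ≤ s i)
    (h9 : Fintype.card V ≤ 9) :
    2 * (0.63664 * (Fintype.card V : ℝ)) ≤ G.laplacianEnergy := by
  have hcard : Fintype.card V = s 0 + s 1 + s 2 + s 3 + p + 5 := by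
    rw [← Fintype.card_congr e, DepthTwoVertex.card_eq, Fin.sum_univ_four]
    omega
  have hs0 := hs 0
  have hs1 := hs 1
  have hs2 := hs 2
  have hs3 := hs 3
  obtain rfl : p = 0 := by omega
  have h0 : s 0 = 1 := by omega
  have h1 : s 1 = 1 := by omega
  have h2 : s 2 = 1 := by omega
  have h3 : s 3 = 1 := by omega
  rw [h0, h1, h2, h3] at hcard
  rw [hcard] at hd ⊢
  have key := le_laplacianEnergy_of_levelVec (J := Fin 4) hform ![13, 0, 0, 0]
    ![![-4, -4, -4, -4], ![3, -3, 0, 0], ![0, 0, 3, -3], ![3, 3, -3, -3]]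
    ![![1, 1, 1, 1], ![-2, 2, 0, 0], ![0, 0, -2, 2], ![-2, -2, 2, 2]] ![0, 0, 0, 0] ?_ ?_
  · simp [Fin.sum_univ_four, h0, h1, h2, h3, hd] at key
    norm_num at key ⊢
    linarith
  · intro i j hij
    fin_cases i <;> fin_cases j <;> simp [Fin.sum_univ_four, h0, h1, h2, h3] at hij ⊢ <;> norm_num
  · intro j
    fin_cases j <;> simp [Fin.sum_univ_four, h0, h1, h2, h3] <;> norm_num

/-- The only tree of diameter four with five vertices is the path. -/
lemma laplacianEnergy_pathGraph_five_le {e : DepthTwoVertex (fun _ : Fin 2 => 1) 0 ≃ V}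
    (hform : ∀ y, G.lapForm (y ∘ e.symm) = form y)
    (hd : G.averageDegree = 2 - 2 / (5 : ℝ)) :
    (pathGraph 5).laplacianEnergy ≤ G.laplacianEnergy := by
  classical
  let f : Fin 5 → DepthTwoVertex (fun _ : Fin 2 => 1) 0 :=
    ![leaf 0 0, hub 0, root, hub 1, leaf 1 0]
  have hinj : Function.Injective f := by decide
  have hbij : Function.Bijective f :=
    (Fintype.bijective_iff_injective_and_card f).2 ⟨hinj, by decide⟩
  let e0 := Equiv.ofBijective f hbij
  have he0 : ∀ (y : Fin 5 → ℝ) (i : Fin 5), (y ∘ e0.symm) (f i) = y i := fun y i =>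
    congrArg y (e0.symm_apply_apply i)
  refine G.laplacianEnergy_le_of_lapForm_comp_le (pathGraph 5) (e0.trans e) ?_ fun y => ?_
  · rw [averageDegree_pathGraph (by norm_num), hd]
    norm_num
  · have h1 : y ∘ (e0.trans e).symm = (y ∘ e0.symm) ∘ e.symm := rfl
    have h2 : (y ∘ e0.symm) root = y 2 := he0 y 2
    have h3 : (y ∘ e0.symm) (hub 0) = y 1 := he0 y 1
    have h4 : (y ∘ e0.symm) (hub 1) = y 3 := he0 y 3
    have h5 : (y ∘ e0.symm) (leaf 0 0) = y 0 := he0 y 0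
    have h6 : (y ∘ e0.symm) (leaf 1 0) = y 4 := he0 y 4
    rw [h1, hform, form, lapForm_eq]
    simp only [Fin.sum_univ_two, Fin.sum_univ_one, h2, h3, h4, h5, h6, Finset.univ_eq_empty,
      Finset.sum_empty, Fin.sum_univ_five, pathGraph_adj]
    norm_num
    linarith

/-- The lower bound for the energy of a tree of diameter four. -/
theorem IsTree.laplacianEnergy_pathGraph_le_of_diam_eq_four (hT : G.IsTree) (hdiam : G.diam = 4) :
    (pathGraph (Fintype.card V)).laplacianEnergy ≤ G.laplacianEnergy := by
  obtain ⟨r, s, p, e, hr, hmono, hs, hform⟩ := hT.exists_depthTwo_equiv hdiam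
  have hd := hT.averageDegree_eq
  have hcard : Fintype.card V = 1 + ((∑ i, (s i + 1)) + p) := by
    rw [← Fintype.card_congr e, DepthTwoVertex.card_eq]
  have hsum : 2 * r ≤ ∑ i, (s i + 1) := by
    have h1 : ∑ _i : Fin r, 2 ≤ ∑ i, (s i + 1) := Finset.sum_le_sum fun i _ => by
      have := hs i
      omega
    simpa [mul_comm] using h1
  rcases Nat.lt_or_ge 5 (Fintype.card V) with h5 | h5
  · refine (laplacianEnergy_pathGraph_le (by omega)).trans ((four_mul_div_pi_le _).trans ?_)
    rcases Nat.lt_or_ge 9 (Fintype.card V) with h9 | h9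
    · exact le_laplacianEnergy_of_ten_le hform hd hr hs h9
    · have hr4 : r ≤ 4 := by omega
      interval_cases r
      · exact le_laplacianEnergy_of_two_branches hform hd hs hmono h5 h9
      · exact le_laplacianEnergy_of_three_branches hform hd hs hmono h9
      · exact le_laplacianEnergy_of_four_branches hform hd hs h9
  · obtain rfl : r = 2 := by omega
    obtain rfl : p = 0 := by omega
    rw [Fin.sum_univ_two] at hcard
    have hs0 := hs 0
    have hs1 := hs 1
    obtain rfl : s = fun _ => 1 := by
      funext i
      fin_cases i
      · simp only [Fin.zero_eta]; omega
      · simp only [Fin.mk_one]; omega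
    have hV : Fintype.card V = 5 := hcard
    rw [hV] at hd ⊢
    exact laplacianEnergy_pathGraph_five_le hform (by rw [hd]; norm_num)

end SimpleGraph

theorem mainTheorem1 {V : Type*} [Fintype V] (T : SimpleGraph V) (hT : T.IsTree)
    (hdiam : T.diam = 4) :
    (SimpleGraph.pathGraph (Fintype.card V)).laplacianEnergy ≤ T.laplacianEnergy ∧
      ∀ c : V, T.laplacianEnergy ≤ (SimpleGraph.starGraph c).laplacianEnergy := by
  refine ⟨hT.laplacianEnergy_pathGraph_le_of_diam_eq_four hdiam, fun c => ?_⟩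
  have := SimpleGraph.nontrivial_of_diam_ne_zero (G := T) (by omega)
  exact (hT.laplacianEnergy_le_of_diam_eq_four hdiam).trans
    (SimpleGraph.le_laplacianEnergy_starGraph c Fintype.one_lt_card)
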